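/- Let $K$ be a field of characteristic zero, let $1\le n\le m$, and let $K(t,\mathbf x)$ be the field of rational functions in $t$ and $\mathbf x=(x_1,\dots,x_m)$ over $K$; write $\hat{\mathbf x}_1=(x_2,\dots,x_m)$. For a variable $v$ let $\sigma_v$ be the $K$-automorphism of $K(t,\mathbf x)$ with $\sigma_v(v)=v+1$ that fixes all other variables, and for an automorphism $\tau$ put $\Delta_\tau(g)=\tau(g)-g$. Let $G_t=\langle\sigma_t,\sigma_{x_1},\dots,\sigma_{x_n}\rangle$ and $G=\langle\sigma_{x_1},\dots,\sigma_{x_n}\rangle$ (free abelian groups), and for a polynomial $d$ let $G_{t,d}=\{\sigma\in G_t:\sigma(d)=d\}$ and $G_d=\{\sigma\in G:\sigma(d)=d\}$. A rational function $f\in K(t,\mathbf x)$ has a telescoper of type $(\sigma_t;\sigma_{x_1},\dots,\sigma_{x_n})$ if there are finitely many $\ell_i\in K(t)$ ($i\ge 0$), not all zero, and $g_1,\dots,g_n\in K(t,\mathbf x)$ such that $\sum_i\ell_i\,\sigma_t^i(f)=\Delta_{\sigma_{x_1}}(g_1)+\cdots+\Delta_{\sigma_{x_n}}(g_n)$. Let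 $f=a/d^j$, where $j\ge 1$, $d\in K[t,\mathbf x]$ is irreducible, and $a\in K(t,\hat{\mathbf x}_1)[x_1]$ satisfies $\deg_{x_1}(a)<\deg_{x_1}(d)$. Assume that $\operatorname{rank}(G_{t,d}/G_d)=1$. Let $\{\tau_0,\tau_1,\dots,\tau_r\}$ ($r\ge 0$) be a $\mathbb Z$-basis of $G_{t,d}$ such that the class $\bar\tau_0$ generates $G_{t,d}/G_d$ and $\{\tau_1,\dots,\tau_r\}$ is a $\mathbb Z$-basis of $G_d$ (empty if $G_d=\{\mathbf 1\}$, in which case the sum on the right below is $0$). Then $f$ has a telescoper of type $(\sigma_t;\sigma_{x_1},\dots,\sigma_{x_n})$ if and only if there exist a nonzero operator $L=\sum_{i=0}^{\rho}\ell_i\,\tau_0^{\,i}$ with coefficients $\ell_i\in K(t)$ and elements $b_1,\dots,b_r\in K(t,\hat{\mathbf x}_1)[x_1]$ with $\deg_{x_1}(b_i)<\deg_{x_1}(d)$ for $1\le i\le r$ such that $$L(a)=\Delta_{\tau_1}(b_1)+\cdots+\Delta_{\tau_r}(b_r).$$ -/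

import Mathlib

noncomputable section

namespace Telescoping

/-- The variables `t, x₁, …, xₘ`: `none` is `t`, and `some i` is `x_{i+1}` for `i : Fin m`. -/
abbrev Var (m : ℕ) : Type := Option (Fin m)

/-- The polynomial ring `K[t, x₁, …, xₘ]`. -/
abbrev MPoly (K : Type*) [Field K] (m : ℕ) : Type _ := MvPolynomial (Var m) K

/-- The field of rational functions `K(t, x₁, …, xₘ)`. -/
abbrev RatFun (K : Type*) [Field K] (m : ℕ) : Type _ := FractionRing (MPoly K m)

/-- A variable as an element of `K(t, x₁, …, xₘ)`. -/
def var (K : Type*) [Field K] {m : ℕ} (v : Var m) : RatFun K m :=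
  algebraMap (MPoly K m) (RatFun K m) (MvPolynomial.X v)

/-- The shift `v ↦ v + 1` (all other variables fixed) on polynomials. -/
def polyShift (K : Type*) [Field K] {m : ℕ} (v : Var m) : MPoly K m ≃ₐ[K] MPoly K m :=
  AlgEquiv.ofAlgHom
    (MvPolynomial.aeval fun w => if w = v then MvPolynomial.X w + 1 else MvPolynomial.X w)
    (MvPolynomial.aeval fun w => if w = v then MvPolynomial.X w - 1 else MvPolynomial.X w)
    (by
      ext w : 1
      by_cases h : w = v <;> simp [h])
    (by
      ext w : 1
      by_cases h : w = v <;> simp [h])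

/-- The shift operator `σ_v`, a `K`-automorphism of `K(t, x₁, …, xₘ)`. -/
def shift (K : Type*) [Field K] {m : ℕ} (v : Var m) : RatFun K m ≃ₐ[K] RatFun K m :=
  IsFractionRing.algEquivOfAlgEquiv (polyShift K v)

theorem shift_var (K : Type*) [Field K] {m : ℕ} (v w : Var m) :
    shift K v (var K w) = if w = v then var K w + 1 else var K w := by
  rw [shift, var, IsFractionRing.algEquivOfAlgEquiv_algebraMap]
  by_cases h : w = v <;> simp [polyShift, h]

theorem shift_comm (K : Type*) [Field K] {m : ℕ} (v w : Var m) :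
    shift K v * shift K w = shift K w * shift K v := by
  have key : ((shift K v * shift K w : RatFun K m ≃ₐ[K] RatFun K m) : RatFun K m →ₐ[K] RatFun K m) =
      ((shift K w * shift K v : RatFun K m ≃ₐ[K] RatFun K m) : RatFun K m →ₐ[K] RatFun K m) := by
    apply IsLocalization.algHom_ext (nonZeroDivisors (MPoly K m))
    apply MvPolynomial.algHom_ext
    intro u
    change shift K v (shift K w (var K u)) = shift K w (shift K v (var K u))
    by_cases h1 : u = v <;> by_cases h2 : u = w <;> simp [shift_var, h1, h2]
    all_goals grind [shift_var]
  exact AlgEquiv.coe_toAlgHom_injective key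

/-- The shift operators `σ_t, σ_{x₁}, …, σ_{xₙ}`. -/
def shiftsT (K : Type*) [Field K] {m n : ℕ} (h : n ≤ m) : Set (RatFun K m ≃ₐ[K] RatFun K m) :=
  insert (shift K none) (Set.range fun i : Fin n => shift K (some (Fin.castLE h i)))

/-- The group `G_t = ⟨σ_t, σ_{x₁}, …, σ_{xₙ}⟩`. -/
def GrpT (K : Type*) [Field K] {m n : ℕ} (h : n ≤ m) : Subgroup (RatFun K m ≃ₐ[K] RatFun K m) :=
  Subgroup.closure (shiftsT K h)

instance GrpT.instCommGroup (K : Type*) [Field K] {m n : ℕ} (h : n ≤ m) :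
    CommGroup (GrpT K h) :=
  { (GrpT K h).toGroup with
    mul_comm := by
      have hc : IsMulCommutative (Subgroup.closure (shiftsT K h)) := by
        apply Subgroup.isMulCommutative_closure
        rintro _ (rfl | ⟨i, rfl⟩) _ (rfl | ⟨k, rfl⟩) <;> exact shift_comm K _ _
      exact hc.is_comm.comm }

/-- The group `G = ⟨σ_{x₁}, …, σ_{xₙ}⟩`, as a subgroup of `G_t`. -/
def GrpX (K : Type*) [Field K] {m n : ℕ} (h : n ≤ m) : Subgroup (GrpT K h) :=
  (Subgroup.closure (Set.range fun i : Fin n => shift K (some (Fin.castLE h i)))).subgroupOf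
    (GrpT K h)

/-- The isotropy group `A_p = {σ ∈ A | σ(p) = p}` of a polynomial `p` in a subgroup `A` of `G_t`. -/
def isotropy {K : Type*} [Field K] {m n : ℕ} {h : n ≤ m} (A : Subgroup (GrpT K h))
    (p : MPoly K m) : Subgroup (GrpT K h) :=
  A ⊓ MulAction.stabilizer (GrpT K h) (algebraMap (MPoly K m) (RatFun K m) p)

theorem mem_isotropy {K : Type*} [Field K] {m n : ℕ} {h : n ≤ m} {A : Subgroup (GrpT K h)}
    {p : MPoly K m} {σ : GrpT K h} :
    σ ∈ isotropy A p ↔ σ ∈ A ∧ (σ : RatFun K m ≃ₐ[K] RatFun K m) (algebraMap _ _ p) =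
      algebraMap _ _ p :=
  Iff.rfl

/-- The isotropy group `G_{t,d}` of `d` in `G_t`. -/
abbrev isoT {K : Type*} [Field K] {m n : ℕ} (h : n ≤ m) (d : MPoly K m) : Subgroup (GrpT K h) :=
  isotropy ⊤ d

/-- The isotropy group `G_d` of `d` in `G`. -/
abbrev isoX {K : Type*} [Field K] {m n : ℕ} (h : n ≤ m) (d : MPoly K m) : Subgroup (GrpT K h) :=
  isotropy (GrpX K h) d

/-- The quotient group `G_{t,d} / G_d`. -/
def isoQuot {K : Type*} [Field K] {m n : ℕ} (h : n ≤ m) (d : MPoly K m) : Type _ :=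
  isoT h d ⧸ (isoX h d).subgroupOf (isoT h d)

instance isoQuot.instCommGroup {K : Type*} [Field K] {m n : ℕ} (h : n ≤ m) (d : MPoly K m) :
    CommGroup (isoQuot h d) :=
  QuotientGroup.Quotient.commGroup ((isoX h d).subgroupOf (isoT h d))

/-- The class `τ̄` in `G_{t,d} / G_d` of an element `τ` of `G_{t,d}`. -/
def isoQuot.mk {K : Type*} [Field K] {m n : ℕ} {h : n ≤ m} {d : MPoly K m} (τ : isoT h d) :
    isoQuot h d :=
  (τ : isoT h d ⧸ (isoX h d).subgroupOf (isoT h d))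

/-- The finite family `τ` is a `ℤ`-basis of the subgroup `H` of the (multiplicatively written)
abelian group `Γ`: it generates `H` and is `ℤ`-linearly independent. The empty family is a basis of
the trivial group. -/
structure IsZBasis {Γ : Type*} [CommGroup Γ] (H : Subgroup Γ) {r : ℕ} (τ : Fin r → Γ) : Prop where
  closure_eq : Subgroup.closure (Set.range τ) = H
  indep : ∀ e : Fin r → ℤ, ∏ i, τ i ^ e i = 1 → ∀ i, e i = 0

/-- The subfield `K(t)` of `K(t, x₁, …, xₘ)`. -/
abbrev fieldT (K : Type*) [Field K] (m : ℕ) : IntermediateField K (RatFun K m) :=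
  IntermediateField.adjoin K {var K none}

/-- The variable `x₁`. -/
abbrev x₁ (m : ℕ) [NeZero m] : Var m := some 0

/-- The subfield `K(t, x₂, …, xₘ)` of `K(t, x₁, …, xₘ)`. -/
abbrev fieldHat (K : Type*) [Field K] (m : ℕ) [NeZero m] : IntermediateField K (RatFun K m) :=
  IntermediateField.adjoin K (var K '' {v | v ≠ x₁ m})

/-- The elements of `K(t, x₂, …, xₘ)[x₁]`, inside `K(t, x₁, …, xₘ)`, of degree in `x₁` less
than `N` (the zero polynomial has degree `-∞`). -/
def polyDegLT (K : Type*) [Field K] (m : ℕ) [NeZero m] (N : ℕ) : Set (RatFun K m) :=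
  {a | ∃ p : Polynomial (fieldHat K m), p.degree < N ∧ Polynomial.aeval (var K (x₁ m)) p = a}

/-- The action `∑ i, ℓᵢ τ^i (f)` on `f` of the recurrence operator `L = ∑ i, ℓᵢ T^i` in
`K(t)⟨T⟩`, where `T` is the operator that acts as the automorphism `τ`. The operator is given by its
finitely many nonzero coefficients `ℓᵢ` in `K(t)`, and it is nonzero iff some `ℓᵢ` is nonzero. -/
def applyOp {K : Type*} [Field K] {m : ℕ} (τ : RatFun K m ≃ₐ[K] RatFun K m)
    (L : ℕ →₀ fieldT K m) (f : RatFun K m) : RatFun K m :=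
  L.sum fun i c => (c : RatFun K m) * (τ ^ i) f

/-- The difference operator `Δ_τ(g) = τ(g) - g`. -/
def deltaOp {K : Type*} [Field K] {m : ℕ} (τ : RatFun K m ≃ₐ[K] RatFun K m) (g : RatFun K m) :
    RatFun K m :=
  τ g - g

/-- The rational function `f` has a telescoper of type `(σ_t; σ_{x₁}, …, σ_{xₙ})`. -/
def HasTelescoper {K : Type*} [Field K] {m n : ℕ} (h : n ≤ m) (f : RatFun K m) : Prop :=
  ∃ L : ℕ →₀ fieldT K m, L ≠ 0 ∧ ∃ g : Fin n → RatFun K m,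
    applyOp (shift K none) L f = ∑ i, deltaOp (shift K (some (Fin.castLE h i))) (g i)

end Telescoping

end

open Telescoping

/-!
Regard `K(t, x₁, …, xₘ)` as the fraction field of `E[x₁]` with `E = K(t, x₂, …, xₘ)`. Every element
of `G_t` is a translation of the variables, so it preserves `E`, the degree in `x₁`, and hence
partial fraction decompositions with respect to `x₁`, whose components it permutes. Write `V` for
the polynomials in `E[x₁]` of degree less than `deg d`, and `W ⊆ V` for the sums
`∑ i, Δ_{τ i} (b i)` with `b i ∈ V`. As `τ₁, …, τᵣ` generate `G_d`, the quotient `V / W` is the group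
of coinvariants of `V` under `G_d`.

For the forward direction, let `π` be the map taking `g` to the numerator in `V` of the term with
denominator `d ^ j` in the partial fraction decomposition of `g` (`polarCoeff`). It is `E`-linear
and commutes with `G_{t,d}`, so `Φ g = ∑ π (σ⁻¹ g) mod W`, summed over `σ ∈ G / G_d`, is well
defined (`transfer`) and invariant under `G`; it therefore kills all `Δ_{x_i} g`. The sum is finite
because the polynomials `σ d` are pairwise non-associated and only those that divide the
denominator of `g` contribute (`translate_eq_of_dvd`, `finite_polarCoeff_ne_zero`). Applied to a
telescoping relation `∑ ℓ_i σ_t ^ i f = ∑ Δ_{x_k} g_k`, shifted so that the exponent `0` occurs,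
`Φ` keeps exactly those terms for which `σ_t ^ i d` is a `G`-translate of `d`, that is, for which
`σ_t ^ i` agrees modulo `G` with a power `τ₀ ^ q`; such a term becomes `ℓ_i τ₀ ^ q a`. Distinct `i`
give distinct `q`, so the resulting relation is nontrivial.

For the converse, a relation for `a` can be divided by the invariant `d ^ j`. The element `τ₀` is
`σ_t ^ k` times an element of `G`, with `k ≠ 0` because the rank is one, and `τ₀ ^ i f` differs from
`σ_t ^ (k i) f` by a sum of differences `Δ_{x_k}`, which is a telescoper up to a shift of exponents
(`exists_applyOp_mem`).
-/

noncomputable section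

namespace Telescoping

open Polynomial

/-! ### Digits of `p`-adic expansions in a rational function field -/

section Digit

variable {E F : Type*} [Field E] [Field F]

/-- `IsDigit φ p h v`: in the `p`-adic expansion of `h ∈ F = Frac E[X]` with digits of degree less
than `deg p`, the digit at `p ^ 0` is `v`. Here `φ` is the embedding of `E[X]` in `F`; the
three summands are the polar part of `h` at `p`, the digit `v`, and a multiple of `p` in
the local ring at `p`. -/
def IsDigit (φ : E[X] →+* F) (p : E[X]) (h : F) (v : E[X]) : Prop :=
  v.degree < p.degree ∧ ∃ (M : ℕ) (c u s : E[X]), c.degree < (p ^ M).degree ∧ ¬ p ∣ s ∧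
    h = φ c / φ p ^ M + φ v + φ p * (φ u / φ s)

variable {φ : E[X] →+* F} {p : E[X]}

theorem IsDigit.unique (hφ : Function.Injective φ) (hp : Prime p) {h : F} {v v' : E[X]}
    (hv : IsDigit φ p h v) (hv' : IsDigit φ p h v') : v = v' := by
  obtain ⟨hd, M, c, u, s, hc, hs, e⟩ := hv
  obtain ⟨hd', M', c', u', s', hc', hs', e'⟩ := hv'
  have hne : ∀ {q : E[X]}, q ≠ 0 → φ q ≠ 0 := fun hq => (map_ne_zero_iff φ hφ).2 hq
  have hs0 : s ≠ 0 := fun h0 => hs (h0 ▸ dvd_zero p)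
  have hs0' : s' ≠ 0 := fun h0 => hs' (h0 ▸ dvd_zero p)
  have hss : ¬ p ∣ s * s' := hp.not_dvd_mul hs hs'
  have hpF := hne hp.ne_zero
  -- Cross-multiplied, the difference of the two expansions is an identity in `E[X]`.
  have key : (c * p ^ M' - c' * p ^ M) * (s * s') =
      p ^ (M + M') * ((v' - v) * (s * s') + p * (u' * s - u * s')) := by
    apply hφ
    have := e.symm.trans e'
    have h1 := hne hs0
    have h2 := hne hs0'
    field_simp at this
    simp only [map_mul, map_sub, map_pow, map_add, pow_add]
    linear_combination this
  have hdvd : p ^ (M + M') ∣ c * p ^ M' - c' * p ^ M :=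
    (hp.pow_dvd_of_dvd_mul_right _ hss) ⟨_, key⟩
  have hdeg : (c * p ^ M' - c' * p ^ M).degree < (p ^ (M + M')).degree := by
    have hpM : ∀ k : ℕ, (p ^ k).degree ≠ ⊥ := fun k => degree_ne_bot.2 (pow_ne_zero _ hp.ne_zero)
    refine lt_of_le_of_lt (degree_sub_le _ _) (max_lt ?_ ?_)
    · rw [degree_mul, pow_add, degree_mul]
      exact WithBot.add_lt_add_right (hpM _) hc
    · rw [degree_mul, add_comm M, pow_add, degree_mul]
      exact WithBot.add_lt_add_right (hpM _) hc'
  have h0 := eq_zero_of_dvd_of_degree_lt hdvd hdeg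
  rw [h0, zero_mul] at key
  have h1 := (mul_eq_zero.1 key.symm).resolve_left (pow_ne_zero _ hp.ne_zero)
  have h2 : p ∣ (v' - v) * (s * s') := ⟨-(u' * s - u * s'), by linear_combination h1⟩
  have h3 := (hp.dvd_or_dvd h2).resolve_right hss
  have h4 := eq_zero_of_dvd_of_degree_lt h3 ((degree_sub_le _ _).trans_lt (max_lt hd' hd))
  exact (sub_eq_zero.1 h4).symm

theorem exists_isDigit (hφ : Function.Injective φ)
    (hfrac : ∀ g : F, ∃ u s : E[X], s ≠ 0 ∧ g = φ u / φ s) (hp : Prime p) (h : F) :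
    ∃ v, IsDigit φ p h v := by
  have hne : ∀ {q : E[X]}, q ≠ 0 → φ q ≠ 0 := fun hq => (map_ne_zero_iff φ hφ).2 hq
  obtain ⟨q, s₀, hs₀, rfl⟩ := hfrac h
  have hfin : FiniteMultiplicity p s₀ := FiniteMultiplicity.of_prime_left hp hs₀
  obtain ⟨s, hs, hps⟩ := hfin.exists_eq_pow_mul_and_not_dvd
  set M := multiplicity p s₀
  have hs0 : s ≠ 0 := fun h0 => hps (h0 ▸ dvd_zero p)
  have hcop : IsCoprime p s := (hp.irreducible.coprime_iff_not_dvd).2 hps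
  obtain ⟨β, α, hαβ⟩ := hcop.pow_left (m := M)
  obtain ⟨δ, γ, hγδ⟩ := hcop
  have hdm : ∀ a b : E[X], b * (a / b) + a % b = a := EuclideanDomain.div_add_mod
  -- `q / (p ^ M * s) = c / p ^ M + w / s` by Bézout and division with remainder, where
  -- `w / s` is integral at `p`; the second Bézout identity then reduces `w / s` modulo `p`.
  set c := (q * α) % p ^ M
  set w := q * β + (q * α / p ^ M) * s with hw
  refine ⟨(w * γ) % p, ?_, M, c, w * γ / p * s + w * δ, s, ?_, hps, ?_⟩
  · exact EuclideanDomain.mod_lt _ hp.ne_zero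
  · exact EuclideanDomain.mod_lt _ (pow_ne_zero _ hp.ne_zero)
  · have e1 : q = c * s + p ^ M * w := by
      have := hdm (q * α) (p ^ M)
      rw [hw]
      linear_combination (-q) * hαβ - s * this
    have e2 : w = (w * γ % p) * s + p * (w * γ / p * s + w * δ) := by
      have := hdm (w * γ) p
      linear_combination (-w) * hγδ - s * this
    clear_value w c
    have f1 := congrArg φ e1
    have f2 := congrArg φ e2
    rw [map_add, map_mul, map_mul, map_pow] at f1
    rw [map_add, map_mul, map_mul φ p] at f2
    rw [hs, map_mul, map_pow]
    have h1 := hne hs0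
    have h2 := hne hp.ne_zero
    field_simp
    rw [f1]
    linear_combination (φ p) ^ M * f2

theorem IsDigit.add (hφ : Function.Injective φ) (hp : Prime p) {h h' : F} {v v' : E[X]}
    (hv : IsDigit φ p h v) (hv' : IsDigit φ p h' v') : IsDigit φ p (h + h') (v + v') := by
  obtain ⟨hd, M, c, u, s, hc, hs, e⟩ := hv
  obtain ⟨hd', M', c', u', s', hc', hs', e'⟩ := hv'
  have hne : ∀ {q : E[X]}, q ≠ 0 → φ q ≠ 0 := fun hq => (map_ne_zero_iff φ hφ).2 hq
  have h1 := hne (fun h0 => hs (h0 ▸ dvd_zero p) : s ≠ 0)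
  have h2 := hne (fun h0 => hs' (h0 ▸ dvd_zero p) : s' ≠ 0)
  have hpF := hne hp.ne_zero
  refine ⟨(degree_add_le _ _).trans_lt (max_lt hd hd'), M + M', c * p ^ M' + c' * p ^ M,
    u * s' + u' * s, s * s', ?_, hp.not_dvd_mul hs hs', ?_⟩
  · have hpM : ∀ k : ℕ, (p ^ k).degree ≠ ⊥ := fun k => degree_ne_bot.2 (pow_ne_zero _ hp.ne_zero)
    refine lt_of_le_of_lt (degree_add_le _ _) (max_lt ?_ ?_)
    · rw [degree_mul, pow_add, degree_mul]
      exact WithBot.add_lt_add_right (hpM _) hc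
    · rw [degree_mul, add_comm M, pow_add, degree_mul]
      exact WithBot.add_lt_add_right (hpM _) hc'
  · rw [e, e']
    simp only [map_add, map_mul, map_pow]
    field_simp
    ring

/-- The digit at `p ^ 0` in the `p`-adic expansion, as an additive map; see `IsDigit`. -/
def digit (hφ : Function.Injective φ) (hfrac : ∀ g : F, ∃ u s : E[X], s ≠ 0 ∧ g = φ u / φ s)
    (hp : Prime p) : F →+ E[X] :=
  AddMonoidHom.mk' (fun g => (exists_isDigit hφ hfrac hp g).choose) fun g g' =>
    (exists_isDigit hφ hfrac hp (g + g')).choose_spec.unique hφ hp <|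
      (exists_isDigit hφ hfrac hp g).choose_spec.add hφ hp
        (exists_isDigit hφ hfrac hp g').choose_spec

theorem isDigit_digit (hφ : Function.Injective φ)
    (hfrac : ∀ g : F, ∃ u s : E[X], s ≠ 0 ∧ g = φ u / φ s) (hp : Prime p) (g : F) :
    IsDigit φ p g (digit hφ hfrac hp g) :=
  (exists_isDigit hφ hfrac hp g).choose_spec

theorem IsDigit.C_mul {h : F} {v : E[X]} (hv : IsDigit φ p h v) (k : E) :
    IsDigit φ p (φ (C k) * h) (C k * v) := by
  obtain ⟨hd, M, c, u, s, hc, hs, rfl⟩ := hv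
  have hle : ∀ q : E[X], (C k * q).degree ≤ q.degree := fun q => by
    rw [← smul_eq_C_mul]; exact degree_smul_le _ _
  refine ⟨(hle _).trans_lt hd, M, C k * c, C k * u, s, (hle _).trans_lt hc, hs, ?_⟩
  simp only [map_mul]
  ring

/-- An element of the local ring at `p` whose residue class is represented by `v`. -/
theorem isDigit_of_integral {v u s : E[X]} (hv : v.degree < p.degree) (hs : ¬ p ∣ s) :
    IsDigit φ p (φ v + φ p * (φ u / φ s)) v :=
  ⟨hv, 0, 0, u, s, by simp, hs, by simp⟩

/-- Digits are equivariant under automorphisms of `F` that fix `p` and preserve the degree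
filtration of `E[X]`. -/
theorem IsDigit.map (hφ : Function.Injective φ) (hp : Prime p) {σ : F ≃+* F}
    (hσ : ∀ (N : ℕ) (u : E[X]), u.degree < N → ∃ u' : E[X], u'.degree < N ∧ φ u' = σ (φ u))
    (hσ' : ∀ (N : ℕ) (u : E[X]), u.degree < N → ∃ u' : E[X], u'.degree < N ∧ φ u' = σ.symm (φ u))
    (hσp : σ (φ p) = φ p) {h : F} {v v' : E[X]} (hv : IsDigit φ p h v) (hv' : φ v' = σ (φ v)) :
    IsDigit φ p (σ h) v' := by
  have hex : ∀ u : E[X], ∃ u' : E[X], φ u' = σ (φ u) := fun u =>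
    (hσ (u.natDegree + 1) u (by
      exact degree_le_natDegree.trans_lt (by exact_mod_cast Nat.lt_succ_self _))).imp fun _ h => h.2
  have hex' : ∀ u : E[X], ∃ u' : E[X], φ u' = σ.symm (φ u) := fun u =>
    (hσ' (u.natDegree + 1) u (by
      exact degree_le_natDegree.trans_lt (by exact_mod_cast Nat.lt_succ_self _))).imp fun _ h => h.2
  have hdeg : ∀ {u q : E[X]}, q ≠ 0 → u.degree < q.degree →
      ∃ u' : E[X], u'.degree < q.degree ∧ φ u' = σ (φ u) := by
    intro u q hq hu
    rw [degree_eq_natDegree hq] at hu ⊢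
    exact hσ _ _ hu
  obtain ⟨hd, M, c, u, s, hc, hs, rfl⟩ := hv
  obtain ⟨v'', hd', e⟩ := hdeg hp.ne_zero hd
  obtain rfl : v'' = v' := hφ (e.trans hv'.symm)
  obtain ⟨c', hc', ec⟩ := hdeg (pow_ne_zero _ hp.ne_zero) hc
  obtain ⟨u', eu⟩ := hex u
  obtain ⟨s', es⟩ := hex s
  refine ⟨hd', M, c', u', s', hc', ?_, ?_⟩
  · rintro ⟨w, hw⟩
    obtain ⟨w', ew⟩ := hex' w
    refine hs ⟨w', hφ ?_⟩
    apply σ.injective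
    rw [← es, hw, map_mul, map_mul, map_mul, hσp, ew, RingEquiv.apply_symm_apply]
  · simp [ec, eu, es, e, hσp]

end Digit

/-! ### Coinvariants and the transfer map -/

section Transfer

variable {Γ A Q : Type*} [Group Γ] [AddCommGroup A] [DistribMulAction Γ A] [AddCommGroup Q]
  (H : Subgroup Γ) (δ : A →+ Q)

/-- The sum of `δ (σ⁻¹ • g)` over representatives `σ` of the cosets in `Γ ⧸ H`. The sum has the
intended meaning when all but finitely many terms vanish, and is independent of the
representatives when `δ` is invariant under `H`. -/
def transfer (g : A) : Q :=
  ∑ᶠ c : Γ ⧸ H, δ (c.out⁻¹ • g)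

variable {H δ}

theorem apply_out_inv_smul (hδ : ∀ τ ∈ H, ∀ g, δ (τ • g) = δ g) (σ : Γ) (g : A) :
    δ ((σ : Γ ⧸ H).out⁻¹ • g) = δ (σ⁻¹ • g) := by
  have hmem : (σ : Γ ⧸ H).out⁻¹ * σ ∈ H := QuotientGroup.eq.1 (QuotientGroup.out_eq' _)
  have := hδ _ hmem (σ⁻¹ • g)
  rwa [smul_smul, mul_assoc, mul_inv_cancel, mul_one] at this

theorem transfer_smul (hδ : ∀ τ ∈ H, ∀ g, δ (τ • g) = δ g) (σ : Γ) (g : A) :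
    transfer H δ (σ • g) = transfer H δ g := by
  rw [transfer, ← finsum_comp_equiv (MulAction.toPerm σ : Equiv.Perm (Γ ⧸ H)), transfer]
  refine finsum_congr fun c => ?_
  obtain ⟨ρ, rfl⟩ := QuotientGroup.mk_surjective c
  rw [MulAction.toPerm_apply, MulAction.Quotient.smul_coe, smul_eq_mul, apply_out_inv_smul hδ,
    apply_out_inv_smul hδ, smul_smul, mul_inv_rev, mul_assoc, inv_mul_cancel, mul_one]

theorem transfer_add (hfin : ∀ g, {c : Γ ⧸ H | δ (c.out⁻¹ • g) ≠ 0}.Finite) (g g' : A) :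
    transfer H δ (g + g') = transfer H δ g + transfer H δ g' := by
  simp only [transfer, smul_add, map_add]
  exact finsum_add_distrib (hfin g) (hfin g')

theorem transfer_zero : transfer H δ 0 = 0 := by
  simp [transfer]

theorem transfer_eq_single (hδ : ∀ τ ∈ H, ∀ g, δ (τ • g) = δ g) (σ : Γ) {g : A}
    (hg : ∀ c : Γ ⧸ H, c ≠ σ → δ (c.out⁻¹ • g) = 0) : transfer H δ g = δ (σ⁻¹ • g) := by
  rw [transfer, finsum_eq_single _ (σ : Γ ⧸ H) hg, apply_out_inv_smul hδ]

end Transfer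

section DeltaSpan

variable {Γ F : Type*} [CommGroup Γ] [Field F] [MulSemiringAction Γ F] {r : ℕ}

/-- The group of all sums `∑ i, (τ i • b i - b i)` with all `b i` in `X`. -/
def deltaSpan (τ : Fin r → Γ) (X : AddSubgroup F) : AddSubgroup F where
  carrier := {w | ∃ b : Fin r → F, (∀ i, b i ∈ X) ∧ w = ∑ i, (τ i • b i - b i)}
  zero_mem' := ⟨0, fun _ => X.zero_mem, by simp⟩
  add_mem' := by
    rintro _ _ ⟨b, hb, rfl⟩ ⟨b', hb', rfl⟩
    refine ⟨b + b', fun i => X.add_mem (hb i) (hb' i), ?_⟩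
    rw [← Finset.sum_add_distrib]
    exact Finset.sum_congr rfl fun i _ => by rw [Pi.add_apply, smul_add]; abel
  neg_mem' := by
    rintro _ ⟨b, hb, rfl⟩
    refine ⟨-b, fun i => X.neg_mem (hb i), ?_⟩
    rw [← Finset.sum_neg_distrib]
    exact Finset.sum_congr rfl fun i _ => by rw [Pi.neg_apply, smul_neg]; abel

variable {τ : Fin r → Γ} {X : AddSubgroup F}

theorem mem_deltaSpan {w : F} :
    w ∈ deltaSpan τ X ↔ ∃ b : Fin r → F, (∀ i, b i ∈ X) ∧ w = ∑ i, (τ i • b i - b i) :=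
  Iff.rfl

/-- The differences under generators span the differences under the whole group. -/
theorem smul_sub_mem_deltaSpan (hX : ∀ σ : Γ, ∀ v ∈ X, σ • v ∈ X) {σ : Γ}
    (hσ : σ ∈ Subgroup.closure (Set.range τ)) {v : F} (hv : v ∈ X) :
    σ • v - v ∈ deltaSpan τ X := by
  induction hσ using Subgroup.closure_induction generalizing v with
  | mem σ hσ =>
    obtain ⟨i, rfl⟩ := hσ
    refine ⟨Pi.single i v, fun k => ?_, ?_⟩
    · by_cases h : k = i
      · subst h; simp [hv]
      · simp [h, X.zero_mem]
    · rw [Finset.sum_eq_single i]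
      · simp
      · intro k _ hk; simp [hk]
      · simp
  | one => simp
  | mul σ ρ _ _ hσ hρ =>
    have := add_mem (hσ (hX ρ v hv)) (hρ hv)
    rwa [smul_smul, sub_add_sub_cancel] at this
  | inv σ _ hσ =>
    have := neg_mem (hσ (hX σ⁻¹ v hv))
    rwa [smul_inv_smul, neg_sub] at this

theorem mul_mem_deltaSpan {l : F} (hl : ∀ i, τ i • l = l) (hX : ∀ v ∈ X, l * v ∈ X) {w : F}
    (hw : w ∈ deltaSpan τ X) : l * w ∈ deltaSpan τ X := by
  obtain ⟨b, hb, rfl⟩ := hw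
  refine ⟨fun i => l * b i, fun i => hX _ (hb i), ?_⟩
  rw [Finset.mul_sum]
  exact Finset.sum_congr rfl fun i _ => by rw [smul_mul', hl, mul_sub]

theorem smul_mem_deltaSpan {σ : Γ} (hX : ∀ v ∈ X, σ • v ∈ X) {w : F}
    (hw : w ∈ deltaSpan τ X) : σ • w ∈ deltaSpan τ X := by
  obtain ⟨b, hb, rfl⟩ := hw
  refine ⟨fun i => σ • b i, fun i => hX _ (hb i), ?_⟩
  rw [Finset.smul_sum]
  exact Finset.sum_congr rfl fun i _ => by rw [smul_sub, smul_smul, smul_smul, mul_comm]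

/-- A transfer map from a subgroup `A` kills the differences under elements of `A`. -/
theorem transfer_eq_zero_of_mem_deltaSpan {Q : Type*} [AddCommGroup Q] {A H : Subgroup Γ}
    {δ : F →+ Q} (hδ : ∀ ρ ∈ H.subgroupOf A, ∀ g, δ (ρ • g) = δ g)
    (hfin : ∀ g, {c : A ⧸ H.subgroupOf A | δ (c.out⁻¹ • g) ≠ 0}.Finite)
    (hτ : ∀ i, τ i ∈ A) {w : F} (hw : w ∈ deltaSpan τ X) :
    transfer (H.subgroupOf A) δ w = 0 := by
  let Φ : F →+ Q := ⟨⟨transfer (H.subgroupOf A) δ, transfer_zero⟩, transfer_add hfin⟩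
  change Φ w = 0
  obtain ⟨b, -, rfl⟩ := hw
  rw [map_sum]
  refine Finset.sum_eq_zero fun i _ => ?_
  rw [map_sub, sub_eq_zero]
  exact transfer_smul hδ (⟨τ i, hτ i⟩ : A) (b i)

end DeltaSpan

/-! ### Translations of polynomials -/

section Translation

variable {K : Type*} [Field K] {m : ℕ}

/-- The translation `v ↦ v + c v` of the variables, on `K[t, x₁, …, xₘ]`. -/
def translate (c : Var m → K) : MPoly K m ≃ₐ[K] MPoly K m :=
  AlgEquiv.ofAlgHom (MvPolynomial.aeval fun v => MvPolynomial.X v + MvPolynomial.C (c v))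
    (MvPolynomial.aeval fun v => MvPolynomial.X v - MvPolynomial.C (c v))
    (by ext v : 1; simp [← MvPolynomial.algebraMap_eq])
    (by ext v : 1; simp [← MvPolynomial.algebraMap_eq])

theorem translate_X (c : Var m → K) (v : Var m) :
    translate c (MvPolynomial.X v) = MvPolynomial.X v + MvPolynomial.C (c v) := by
  simp [translate]

/-- A translate of an irreducible polynomial `d` that is divisible by `d` is `d` itself. It is
`l * d` for a constant `l`; substituting `v + Y * c v` for each variable `v`, with a new variable
`Y`, turns `d` into a polynomial `D(Y)` such that `D(Y + 1) = l * D(Y)`, and the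
leading coefficients show `l = 1`. -/
theorem translate_eq_of_dvd {d : MPoly K m} (hd : Irreducible d) (c : Var m → K)
    (h : d ∣ translate c d) : translate c d = d := by
  have hirr : Irreducible (translate c d) := (MulEquiv.irreducible_iff (translate c)).2 hd
  obtain ⟨w, hw⟩ := h
  have hunit : IsUnit w := (hirr.isUnit_or_isUnit hw).resolve_left hd.not_isUnit
  obtain ⟨l, -, rfl⟩ := MvPolynomial.isUnit_iff_eq_C_of_isReduced.1 hunit
  let θ : MPoly K m →ₐ[K] (MPoly K m)[X] :=
    MvPolynomial.aeval fun v => C (MvPolynomial.X v) + C (MvPolynomial.C (c v)) * X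
  have hθ : ∀ u, θ (translate c u) = taylor 1 (θ u) := by
    intro u
    have : θ.comp (translate c : MPoly K m →ₐ[K] MPoly K m) =
        ((taylorAlgHom (1 : MPoly K m)).restrictScalars K).comp θ := by
      ext v : 1
      simp [θ, translate_X, ← MvPolynomial.algebraMap_eq, Polynomial.algebraMap_apply,
        mul_add]
      ring
    exact DFunLike.congr_fun this u
  have hev : ∀ u, (θ u).eval 0 = u := by
    intro u
    have : ((aeval (0 : MPoly K m)).restrictScalars K).comp θ = AlgHom.id K (MPoly K m) := by
      ext v : 1
      simp [θ]
    have := DFunLike.congr_fun this u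
    simpa [coe_aeval_eq_eval] using this
  have hne : θ d ≠ 0 := fun h0 => hd.ne_zero (by rw [← hev d, h0, eval_zero])
  have e : taylor 1 (θ d) = θ d * C (MvPolynomial.C l) := by
    rw [← hθ, hw, map_mul, ← MvPolynomial.algebraMap_eq, AlgHom.commutes,
      Polynomial.algebraMap_apply]
  have e' := congrArg leadingCoeff e
  rw [leadingCoeff_taylor, leadingCoeff_mul, leadingCoeff_C] at e'
  have hl : MvPolynomial.C l = (1 : MPoly K m) :=
    (mul_left_cancel₀ (leadingCoeff_ne_zero.2 hne) (by rw [mul_one]; exact e')).symm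
  rw [hw, hl, mul_one]

theorem algEquiv_algebraMap {σ : RatFun K m ≃ₐ[K] RatFun K m} {c : Var m → K}
    (hσ : ∀ v, σ (var K v) = var K v + algebraMap K _ (c v)) (u : MPoly K m) :
    σ (algebraMap _ _ u) = algebraMap _ _ (translate c u) := by
  have : (σ : RatFun K m →ₐ[K] RatFun K m).comp
      (IsScalarTower.toAlgHom K (MPoly K m) (RatFun K m)) =
      (IsScalarTower.toAlgHom K (MPoly K m) (RatFun K m)).comp
        (translate c : MPoly K m →ₐ[K] MPoly K m) := by
    ext v : 1
    have := hσ v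
    rw [var] at this
    simp [translate_X, this, IsScalarTower.algebraMap_apply K (MPoly K m) (RatFun K m) (c v)]
  exact DFunLike.congr_fun this u

theorem algebraicIndependent_var : AlgebraicIndependent K (var K : Var m → RatFun K m) := by
  have : (var K : Var m → RatFun K m) =
      IsScalarTower.toAlgHom K (MPoly K m) (RatFun K m) ∘ MvPolynomial.X := rfl
  rw [this]
  exact (MvPolynomial.algebraicIndependent_X (Var m) K).map' (IsFractionRing.injective _ _)

/-! ### `K(t, x₁, …, xₘ)` as the fraction field of `K(t, x₂, …, xₘ)[x₁]` -/

section Hat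

variable [NeZero m]

variable (K m) in
/-- The inclusion of `K(t, x₂, …, xₘ)[x₁]` in `K(t, x₁, …, xₘ)`. -/
def evalX₁ : (fieldHat K m)[X] →+* RatFun K m :=
  (aeval (var K (x₁ m)) : (fieldHat K m)[X] →ₐ[fieldHat K m] RatFun K m).toRingHom

theorem evalX₁_C (e : fieldHat K m) : evalX₁ K m (C e) = e :=
  aeval_C (var K (x₁ m)) e

theorem evalX₁_X : evalX₁ K m X = var K (x₁ m) :=
  aeval_X (var K (x₁ m))

theorem mem_polyDegLT {N : ℕ} {a : RatFun K m} :
    a ∈ polyDegLT K m N ↔ ∃ p : (fieldHat K m)[X], p.degree < N ∧ evalX₁ K m p = a :=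
  Iff.rfl

theorem var_mem_fieldHat {v : Var m} (hv : v ≠ x₁ m) : var K v ∈ fieldHat K m :=
  IntermediateField.subset_adjoin K _ ⟨v, hv, rfl⟩

theorem fieldT_le_fieldHat : fieldT K m ≤ fieldHat K m :=
  IntermediateField.adjoin_le_iff.2 (by
    rintro _ rfl
    exact var_mem_fieldHat (by simp))

open scoped IntermediateField.algebraAdjoinAdjoin in
theorem evalX₁_injective : Function.Injective (evalX₁ K m) := by
  have h1 : Transcendental (Algebra.adjoin K (var K '' {v : Var m | v ≠ x₁ m})) (var K (x₁ m)) :=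
    algebraicIndependent_var.transcendental_adjoin (by simp)
  have h2 : Transcendental (fieldHat K m) (var K (x₁ m)) := fun h =>
    h1 ((IsFractionRing.isAlgebraic_iff _ (fieldHat K m) (RatFun K m)).2 h)
  exact transcendental_iff_injective.1 h2

/-- The inclusion of `K[t, x₂, …, xₘ]` in its fraction field `K(t, x₂, …, xₘ)`. -/
def hatCoeff : MvPolynomial {v : Var m // v ≠ x₁ m} K →ₐ[K] fieldHat K m :=
  MvPolynomial.aeval fun v => ⟨var K v.1, var_mem_fieldHat v.2⟩

theorem coe_hatCoeff (r : MvPolynomial {v : Var m // v ≠ x₁ m} K) :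
    (hatCoeff r : RatFun K m) = algebraMap _ _ (MvPolynomial.rename Subtype.val r) := by
  have : (fieldHat K m).val.comp hatCoeff =
      (IsScalarTower.toAlgHom K (MPoly K m) (RatFun K m)).comp
        (MvPolynomial.rename (Subtype.val : {v : Var m // v ≠ x₁ m} → Var m)) := by
    ext v : 1
    simp [hatCoeff, var]
  exact DFunLike.congr_fun this r

theorem hatCoeff_injective : Function.Injective (hatCoeff (K := K) (m := m)) := fun r s h => by
  have := congrArg (Subtype.val) h
  rw [coe_hatCoeff, coe_hatCoeff] at this
  exact MvPolynomial.rename_injective _ Subtype.val_injective (IsFractionRing.injective _ _ this)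

theorem exists_hatCoeff_div (e : fieldHat K m) :
    ∃ r s : MvPolynomial {v : Var m // v ≠ x₁ m} K,
      hatCoeff s ≠ 0 ∧ e = hatCoeff r / hatCoeff s := by
  obtain ⟨e, he⟩ := e
  have hr : var K '' {v : Var m | v ≠ x₁ m} =
      Set.range fun v : {v : Var m // v ≠ x₁ m} => var K v.1 := by
    ext; simp
  have he' := he
  rw [fieldHat, hr, IntermediateField.mem_adjoin_range_iff] at he'
  obtain ⟨r, s, h⟩ := he'
  have hcoe : ∀ q : MvPolynomial {v : Var m // v ≠ x₁ m} K,
      (hatCoeff q : RatFun K m) =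
        MvPolynomial.aeval (fun v : {v : Var m // v ≠ x₁ m} => var K v.1) q :=
    fun q => by
    have : (fieldHat K m).val.comp hatCoeff =
        MvPolynomial.aeval (fun v : {v : Var m // v ≠ x₁ m} => var K v.1) := by
      ext v : 1
      simp [hatCoeff]
    exact DFunLike.congr_fun this q
  by_cases hs : hatCoeff (K := K) s = 0
  · refine ⟨0, 1, by simp, Subtype.ext (h.trans ?_)⟩
    rw [← hcoe s, hs]
    simp
  · exact ⟨r, s, hs, Subtype.ext (h.trans (by rw [← hcoe, ← hcoe]; rfl))⟩

variable (K m) in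
/-- The inclusion of `K[t, x₁, …, xₘ]` in `K(t, x₂, …, xₘ)[x₁]`. -/
def toHat : MPoly K m →ₐ[K] (fieldHat K m)[X] :=
  (mapAlgHom hatCoeff).comp <|
    (MvPolynomial.optionEquivLeft K {v : Var m // v ≠ x₁ m} : _ →ₐ[K] _).comp <|
      MvPolynomial.rename (Equiv.optionSubtypeNe (x₁ m)).symm

theorem natDegree_toHat (u : MPoly K m) : (toHat K m u).natDegree = u.degreeOf (x₁ m) := by
  rw [MvPolynomial.degreeOf_eq_natDegree]
  have : toHat K m u = Polynomial.map (hatCoeff (K := K) (m := m)).toRingHom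
      (MvPolynomial.optionEquivLeft K {v : Var m // v ≠ x₁ m}
        (MvPolynomial.rename (Equiv.optionSubtypeNe (x₁ m)).symm u)) := by
    simp [toHat]
  rw [this, natDegree_map_eq_of_injective hatCoeff_injective]

theorem evalX₁_toHat (u : MPoly K m) : evalX₁ K m (toHat K m u) = algebraMap _ _ u := by
  have : ((aeval (var K (x₁ m)) : (fieldHat K m)[X] →ₐ[fieldHat K m] RatFun K m).restrictScalars
      K).comp (toHat K m) =
      IsScalarTower.toAlgHom K (MPoly K m) (RatFun K m) := by
    ext v : 1
    by_cases hv : v = x₁ m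
    · subst hv
      simp [toHat, var]
    · have : (Equiv.optionSubtypeNe (x₁ m)).symm v = some ⟨v, hv⟩ :=
        Equiv.optionSubtypeNe_symm_of_ne hv
      simp [toHat, var, this, hatCoeff]
  exact DFunLike.congr_fun this u

theorem toHat_injective : Function.Injective (toHat K m) := fun u w h => by
  have := congrArg (evalX₁ K m) h
  rw [evalX₁_toHat, evalX₁_toHat] at this
  exact IsFractionRing.injective _ _ this

theorem toHat_rename (r : MvPolynomial {v : Var m // v ≠ x₁ m} K) :
    toHat K m (MvPolynomial.rename Subtype.val r) = C (hatCoeff r) := by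
  apply evalX₁_injective
  rw [evalX₁_toHat, ← coe_hatCoeff, evalX₁_C]

/-- Clearing denominators in the coefficients of `q`. -/
theorem exists_toHat_mul (q : (fieldHat K m)[X]) :
    ∃ (γ u : MPoly K m) (k : fieldHat K m), k ≠ 0 ∧ toHat K m γ = C k ∧
      toHat K m γ * q = toHat K m u := by
  induction q using Polynomial.induction_on' with
  | add q q' hq hq' =>
    obtain ⟨γ, u, k, hk, hγ, hu⟩ := hq
    obtain ⟨γ', u', k', hk', hγ', hu'⟩ := hq'
    refine ⟨γ * γ', γ' * u + γ * u', k * k', mul_ne_zero hk hk', by simp [hγ, hγ'], ?_⟩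
    simp only [map_mul, map_add, ← hu, ← hu']
    ring
  | monomial i e =>
    obtain ⟨r, s, hs, rfl⟩ := exists_hatCoeff_div e
    refine ⟨MvPolynomial.rename Subtype.val s,
      MvPolynomial.rename Subtype.val r * MvPolynomial.X (x₁ m) ^ i, _, hs, toHat_rename s, ?_⟩
    have hX : toHat K m (MvPolynomial.X (x₁ m)) = X := by simp [toHat]
    rw [map_mul, map_pow, hX, toHat_rename, toHat_rename, ← C_mul_X_pow_eq_monomial, ← mul_assoc,
      ← C_mul, mul_div_cancel₀ _ hs]

theorem exists_evalX₁_div (g : RatFun K m) :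
    ∃ u s : (fieldHat K m)[X], s ≠ 0 ∧ g = evalX₁ K m u / evalX₁ K m s := by
  obtain ⟨u, s, hs, rfl⟩ := IsFractionRing.div_surjective (A := MPoly K m) g
  refine ⟨toHat K m u, toHat K m s, ?_, by rw [evalX₁_toHat, evalX₁_toHat]⟩
  exact (map_ne_zero_iff _ toHat_injective).2 (nonZeroDivisors.ne_zero hs)

section Irreducible

variable {d : MPoly K m}

theorem not_dvd_of_toHat_eq_C (hdeg : 0 < d.degreeOf (x₁ m)) {γ : MPoly K m} {k : fieldHat K m}
    (hk : k ≠ 0) (hγ : toHat K m γ = C k) : ¬ d ∣ γ := by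
  rintro ⟨w, rfl⟩
  rw [map_mul] at hγ
  have hne : toHat K m d * toHat K m w ≠ 0 := by rw [hγ]; exact C_ne_zero.2 hk
  have := congrArg natDegree hγ
  rw [natDegree_C, natDegree_mul (left_ne_zero_of_mul hne) (right_ne_zero_of_mul hne),
    natDegree_toHat] at this
  omega

/-- Divisibility by `d` in `K(t, x₂, …, xₘ)[x₁]` is divisibility in `K[t, x₁, …, xₘ]`, a form of
Gauss's lemma. -/
theorem toHat_dvd_toHat_iff (hd : Irreducible d) (hdeg : 0 < d.degreeOf (x₁ m)) {s : MPoly K m} :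
    toHat K m d ∣ toHat K m s ↔ d ∣ s := by
  refine ⟨?_, fun h => map_dvd _ h⟩
  rintro ⟨q, hq⟩
  obtain ⟨γ, u, k, hk, hγ, hu⟩ := exists_toHat_mul q
  have e : γ * s = d * u := toHat_injective (by
    rw [map_mul, map_mul, ← hu, hq]; ring)
  exact (hd.prime.dvd_or_dvd ⟨u, e⟩).resolve_left (not_dvd_of_toHat_eq_C hdeg hk hγ)

theorem prime_toHat (hd : Irreducible d) (hdeg : 0 < d.degreeOf (x₁ m)) : Prime (toHat K m d) := by
  refine ⟨(map_ne_zero_iff _ toHat_injective).2 hd.ne_zero, fun h => ?_, fun q q' h => ?_⟩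
  · have := natDegree_eq_zero_of_isUnit h
    rw [natDegree_toHat] at this
    omega
  · obtain ⟨γ, u, k, hk, hγ, hu⟩ := exists_toHat_mul q
    obtain ⟨γ', u', k', hk', hγ', hu'⟩ := exists_toHat_mul q'
    have h' : toHat K m d ∣ toHat K m (u * u') := by
      rw [map_mul, ← hu, ← hu', mul_mul_mul_comm]
      exact h.mul_left _
    rcases hd.prime.dvd_or_dvd ((toHat_dvd_toHat_iff hd hdeg).1 h') with h1 | h1
    · left
      have := (toHat_dvd_toHat_iff hd hdeg).2 h1
      rw [← hu, hγ] at this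
      exact (isUnit_C.2 (isUnit_iff_ne_zero.2 hk)).dvd_mul_left.1 this
    · right
      have := (toHat_dvd_toHat_iff hd hdeg).2 h1
      rw [← hu', hγ'] at this
      exact (isUnit_C.2 (isUnit_iff_ne_zero.2 hk')).dvd_mul_left.1 this

end Irreducible

end Hat

end Translation

/-! ### The action of `G_t` on polynomials and rational functions -/

section Action

variable {K : Type*} [Field K] {m n : ℕ} {h : n ≤ m}

theorem GrpT.smul_def (σ : GrpT K h) (f : RatFun K m) :
    σ • f = (σ : RatFun K m ≃ₐ[K] RatFun K m) f :=
  rfl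

variable (K h) in
/-- `σ_t` as an element of `G_t`. -/
def shiftT : GrpT K h :=
  ⟨shift K none, Subgroup.subset_closure (Set.mem_insert _ _)⟩

variable (K h) in
/-- `σ_{x_{i+1}}` as an element of `G_t`. -/
def shiftX (i : Fin n) : GrpT K h :=
  ⟨shift K (some (Fin.castLE h i)), Subgroup.subset_closure (Set.mem_insert_of_mem _ ⟨i, rfl⟩)⟩

theorem closure_range_shiftX : Subgroup.closure (Set.range (shiftX K h)) = GrpX K h := by
  apply Subgroup.map_injective (GrpT K h).subtype_injective
  rw [GrpX, Subgroup.subgroupOf_map_subtype, MonoidHom.map_closure, ← Set.range_comp]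
  exact (inf_of_le_left (Subgroup.closure_mono (Set.subset_insert _ _))).symm

theorem exists_eq_shiftT_zpow_mul (σ : GrpT K h) :
    ∃ (k : ℤ) (ρ : GrpT K h), ρ ∈ GrpX K h ∧ σ = shiftT K h ^ k * ρ := by
  have htop : Subgroup.zpowers (shiftT K h) ⊔ GrpX K h = ⊤ := by
    have hcl : Subgroup.closure ((↑) ⁻¹' shiftsT K h : Set (GrpT K h)) = ⊤ :=
      Subgroup.closure_closure_coe_preimage
    rw [eq_top_iff, ← hcl, Subgroup.closure_le]
    rintro ⟨σ, hσ⟩ (rfl | ⟨i, rfl⟩)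
    · exact Subgroup.mem_sup_left (Subgroup.mem_zpowers (shiftT K h))
    · apply Subgroup.mem_sup_right
      rw [← closure_range_shiftX]
      exact Subgroup.subset_closure ⟨i, rfl⟩
  have hσ : σ ∈ Subgroup.zpowers (shiftT K h) ⊔ GrpX K h := htop ▸ Subgroup.mem_top σ
  obtain ⟨_, ⟨k, rfl⟩, ρ, hρ, rfl⟩ := Subgroup.mem_sup.1 hσ
  exact ⟨k, ρ, hρ, rfl⟩

theorem exists_smul_var (σ : GrpT K h) :
    ∃ c : Var m → K, ∀ v, σ • var K v = var K v + algebraMap K _ (c v) := by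
  obtain ⟨σ, hσ⟩ := σ
  change ∃ c : Var m → K, ∀ v, σ (var K v) = var K v + algebraMap K _ (c v)
  have hshift : ∀ w : Var m, ∃ c : Var m → K,
      ∀ v, shift K w (var K v) = var K v + algebraMap K _ (c v) := fun w => by
    refine ⟨fun v => if v = w then 1 else 0, fun v => ?_⟩
    rw [shift_var]
    split_ifs with hv <;> simp [hv]
  induction hσ using Subgroup.closure_induction with
  | mem σ hσ =>
    obtain rfl | ⟨i, rfl⟩ := hσ
    · exact hshift _
    · exact hshift _
  | one => exact ⟨0, fun v => by simp⟩
  | mul σ ρ _ _ hσ hρ =>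
    obtain ⟨c, hc⟩ := hσ
    obtain ⟨c', hc'⟩ := hρ
    refine ⟨c + c', fun v => ?_⟩
    rw [AlgEquiv.mul_apply, hc', map_add, hc, AlgEquiv.commutes, Pi.add_apply, map_add, add_assoc]
  | inv σ _ hσ =>
    obtain ⟨c, hc⟩ := hσ
    refine ⟨-c, fun v => σ.injective ?_⟩
    rw [← AlgEquiv.mul_apply, mul_inv_cancel, AlgEquiv.one_apply, map_add, hc, AlgEquiv.commutes,
      Pi.neg_apply, map_neg, add_neg_cancel_right]

/-- The action of an element of `G_t` on polynomials. -/
def polySmul (σ : GrpT K h) : MPoly K m ≃ₐ[K] MPoly K m :=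
  translate (exists_smul_var σ).choose

theorem algebraMap_polySmul (σ : GrpT K h) (u : MPoly K m) :
    algebraMap _ (RatFun K m) (polySmul σ u) = σ • algebraMap _ (RatFun K m) u :=
  (algEquiv_algebraMap (exists_smul_var σ).choose_spec u).symm

theorem polySmul_mul (σ ρ : GrpT K h) (u : MPoly K m) :
    polySmul (σ * ρ) u = polySmul σ (polySmul ρ u) := by
  apply IsFractionRing.injective (MPoly K m) (RatFun K m)
  rw [algebraMap_polySmul, algebraMap_polySmul, algebraMap_polySmul, mul_smul]

theorem polySmul_one (u : MPoly K m) : polySmul (1 : GrpT K h) u = u := by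
  apply IsFractionRing.injective (MPoly K m) (RatFun K m)
  rw [algebraMap_polySmul, one_smul]

theorem polySmul_inv_polySmul (σ : GrpT K h) (u : MPoly K m) :
    polySmul σ⁻¹ (polySmul σ u) = u := by
  apply IsFractionRing.injective (MPoly K m) (RatFun K m)
  rw [algebraMap_polySmul, algebraMap_polySmul, inv_smul_smul]

theorem mem_isoT_of_dvd {d : MPoly K m} (hd : Irreducible d) {σ : GrpT K h}
    (hσ : d ∣ polySmul σ d) : σ ∈ isoT h d := by
  refine mem_isotropy.2 ⟨Subgroup.mem_top σ, ?_⟩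
  rw [← GrpT.smul_def, ← algebraMap_polySmul, polySmul, translate_eq_of_dvd hd _ hσ]

theorem smul_eq_of_mem_isoT {d : MPoly K m} {σ : GrpT K h} (hσ : σ ∈ isoT h d) :
    σ • algebraMap (MPoly K m) (RatFun K m) d = algebraMap _ _ d :=
  (mem_isotropy.1 hσ).2

theorem mem_isoX_iff {d : MPoly K m} {σ : GrpT K h} :
    σ ∈ isoX h d ↔ σ ∈ GrpX K h ∧ σ ∈ isoT h d := by
  rw [mem_isotropy, mem_isotropy]
  simp

/-! ### The coefficient field `K(t)` -/

theorem smul_var_none_of_mem_GrpX {σ : GrpT K h} (hσ : σ ∈ GrpX K h) :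
    σ • var K (none : Var m) = var K none := by
  rw [← closure_range_shiftX] at hσ
  have hle : Subgroup.closure (Set.range (shiftX K h)) ≤
      MulAction.stabilizer (GrpT K h) (var K (none : Var m)) := by
    rw [Subgroup.closure_le]
    rintro _ ⟨i, rfl⟩
    change shift K _ _ = _
    rw [shift_var, if_neg (by simp)]
  exact hle hσ

theorem shiftT_zpow_mem_GrpX_iff [CharZero K] {k : ℤ} : shiftT K h ^ k ∈ GrpX K h ↔ k = 0 := by
  refine ⟨fun hk => ?_, fun hk => by rw [hk, zpow_zero]; exact one_mem _⟩
  have h1 : shiftT K h • var K (none : Var m) = var K none + 1 := by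
    change shift K _ _ = _
    rw [shift_var, if_pos rfl]
  have hnat : ∀ i : ℕ, shiftT K h ^ i • var K (none : Var m) = var K none + (i : RatFun K m) := by
    intro i
    induction i with
    | zero => simp
    | succ i ih =>
      rw [pow_succ', mul_smul, ih, smul_add, h1]
      have : shiftT K h • (i : RatFun K m) = i := map_natCast (shift K none) i
      rw [this]
      push_cast
      ring
  have key : ∀ i : ℕ, shiftT K h ^ i ∈ GrpX K h → i = 0 := by
    intro i hi
    have := smul_var_none_of_mem_GrpX hi
    rw [hnat, add_eq_left] at this
    have hc : CharZero (RatFun K m) := charZero_of_injective_algebraMap (algebraMap K _).injective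
    exact_mod_cast this
  obtain ⟨i, rfl | rfl⟩ := k.eq_nat_or_neg
  · rw [zpow_natCast] at hk
    exact_mod_cast key i hk
  · rw [zpow_neg, inv_mem_iff, zpow_natCast] at hk
    simpa using key i hk

theorem smul_eq_of_mem_GrpX {σ : GrpT K h} (hσ : σ ∈ GrpX K h) {l : RatFun K m}
    (hl : l ∈ fieldT K m) : σ • l = l := by
  induction hl using IntermediateField.adjoin_induction with
  | mem x hx =>
    rw [Set.mem_singleton_iff.1 hx]
    exact smul_var_none_of_mem_GrpX hσ
  | algebraMap x => exact AlgEquiv.commutes _ x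
  | add x y _ _ hx hy => rw [smul_add, hx, hy]
  | inv x _ hx => rw [smul_inv'', hx]
  | mul x y _ _ hx hy => rw [smul_mul', hx, hy]

theorem smul_mem_adjoin_var (σ : GrpT K h) (s : Set (Var m)) {l : RatFun K m}
    (hl : l ∈ IntermediateField.adjoin K (var K '' s)) :
    σ • l ∈ IntermediateField.adjoin K (var K '' s) := by
  induction hl using IntermediateField.adjoin_induction with
  | mem x hx =>
    obtain ⟨v, hv, rfl⟩ := hx
    obtain ⟨c, hc⟩ := exists_smul_var σ
    rw [hc]
    exact add_mem (IntermediateField.subset_adjoin K _ ⟨v, hv, rfl⟩)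
      (IntermediateField.algebraMap_mem _ _)
  | algebraMap x =>
    have : σ • algebraMap K (RatFun K m) x = algebraMap K _ x := AlgEquiv.commutes _ x
    rw [this]
    exact IntermediateField.algebraMap_mem _ _
  | add x y _ _ hx hy => rw [smul_add]; exact add_mem hx hy
  | inv x _ hx => rw [smul_inv'']; exact inv_mem hx
  | mul x y _ _ hx hy => rw [smul_mul']; exact mul_mem hx hy

theorem smul_mem_fieldT (σ : GrpT K h) {l : RatFun K m} (hl : l ∈ fieldT K m) :
    σ • l ∈ fieldT K m := by
  have := smul_mem_adjoin_var σ {none} (l := l)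
  rw [Set.image_singleton] at this
  exact this hl

/-! ### The polynomials in `x₁` of bounded degree -/

section Deg

variable [NeZero m]

theorem smul_mem_fieldHat (σ : GrpT K h) {l : RatFun K m} (hl : l ∈ fieldHat K m) :
    σ • l ∈ fieldHat K m :=
  smul_mem_adjoin_var σ _ hl

variable (K m) in
/-- `polyDegLT` as an additive subgroup. -/
def polyDegLTAddSubgroup (N : ℕ) : AddSubgroup (RatFun K m) :=
  (degreeLT (fieldHat K m) N).toAddSubgroup.map (evalX₁ K m).toAddMonoidHom

theorem mem_polyDegLTAddSubgroup {N : ℕ} {a : RatFun K m} :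
    a ∈ polyDegLTAddSubgroup K m N ↔ a ∈ polyDegLT K m N := by
  rw [mem_polyDegLT, polyDegLTAddSubgroup, AddSubgroup.mem_map]
  simp [mem_degreeLT]

theorem mul_mem_polyDegLT {N : ℕ} {l a : RatFun K m} (hl : l ∈ fieldHat K m)
    (ha : a ∈ polyDegLTAddSubgroup K m N) : l * a ∈ polyDegLTAddSubgroup K m N := by
  rw [mem_polyDegLTAddSubgroup, mem_polyDegLT] at *
  obtain ⟨p, hp, rfl⟩ := ha
  refine ⟨C ⟨l, hl⟩ * p, ?_, ?_⟩
  · rw [← smul_eq_C_mul]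
    exact (degree_smul_le _ _).trans_lt hp
  · rw [map_mul, evalX₁_C]

theorem smul_mem_polyDegLT {N : ℕ} (σ : GrpT K h) {a : RatFun K m}
    (ha : a ∈ polyDegLTAddSubgroup K m N) : σ • a ∈ polyDegLTAddSubgroup K m N := by
  obtain ⟨p, hp, rfl⟩ := mem_polyDegLT.1 (mem_polyDegLTAddSubgroup.1 ha)
  obtain ⟨c, hc⟩ := exists_smul_var σ
  have e : evalX₁ K m p = _ := aeval_eq_sum_range (p := p) (var K (x₁ m))
  rw [e, Finset.smul_sum]
  refine sum_mem fun i hi => ?_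
  by_cases h0 : p.coeff i = 0
  · rw [h0, zero_smul, smul_zero]
    exact zero_mem _
  have hiN : (i : WithBot ℕ) < N := (le_degree_of_ne_zero h0).trans_lt hp
  rw [Algebra.smul_def, smul_mul', smul_pow', hc]
  refine mul_mem_polyDegLT (smul_mem_fieldHat σ (p.coeff i).2) ?_
  rw [mem_polyDegLTAddSubgroup, mem_polyDegLT]
  refine ⟨(X + C (algebraMap K _ (c (x₁ m)))) ^ i, ?_, ?_⟩
  · rwa [degree_pow, degree_X_add_C, nsmul_one]
  · rw [map_pow, map_add, evalX₁_X, evalX₁_C]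
    rfl

end Deg

end Action

/-! ### Polar parts at `d` with respect to `x₁` -/

section PolarPart

variable {K : Type*} [Field K] {m n : ℕ} {h : n ≤ m} [NeZero m] {d : MPoly K m}

variable (hd : Irreducible d) (hdeg : 0 < d.degreeOf (x₁ m)) (j : ℕ)

/-- The digit of a rational function at `d ^ 0`, with respect to the variable `x₁`. -/
def digitX₁ : RatFun K m →+ (fieldHat K m)[X] :=
  digit (φ := evalX₁ K m) (p := toHat K m d) evalX₁_injective exists_evalX₁_div
    (prime_toHat hd hdeg)

theorem isDigit_digitX₁ (g : RatFun K m) :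
    IsDigit (evalX₁ K m) (toHat K m d) g (digitX₁ hd hdeg g) :=
  isDigit_digit (φ := evalX₁ K m) (p := toHat K m d) evalX₁_injective exists_evalX₁_div
    (prime_toHat hd hdeg) g

/-- The numerator `b` of the term `b / d ^ j`, with `deg b < deg d`, in the partial fraction
decomposition with respect to `x₁`. -/
def polarCoeff : RatFun K m →+ RatFun K m :=
  ((evalX₁ K m).toAddMonoidHom.comp (digitX₁ hd hdeg)).comp
    (AddMonoidHom.mulLeft (algebraMap (MPoly K m) (RatFun K m) d ^ j))

theorem polarCoeff_apply (g : RatFun K m) :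
    polarCoeff hd hdeg j g =
      evalX₁ K m (digitX₁ hd hdeg (algebraMap (MPoly K m) (RatFun K m) d ^ j * g)) :=
  rfl

theorem polarCoeff_eq {g : RatFun K m} {v : (fieldHat K m)[X]}
    (hv : IsDigit (evalX₁ K m) (toHat K m d)
      (algebraMap (MPoly K m) (RatFun K m) d ^ j * g) v) :
    polarCoeff hd hdeg j g = evalX₁ K m v := by
  have := IsDigit.unique (φ := evalX₁ K m) (p := toHat K m d) evalX₁_injective
    (prime_toHat hd hdeg) (isDigit_digitX₁ hd hdeg _) hv
  rw [polarCoeff_apply, this]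

include hd in
theorem degree_toHat : (toHat K m d).degree = (d.degreeOf (x₁ m) : WithBot ℕ) := by
  rw [degree_eq_natDegree ((map_ne_zero_iff _ toHat_injective).2 hd.ne_zero), natDegree_toHat]

theorem polarCoeff_mem (g : RatFun K m) :
    polarCoeff hd hdeg j g ∈ polyDegLTAddSubgroup K m (d.degreeOf (x₁ m)) := by
  rw [mem_polyDegLTAddSubgroup, mem_polyDegLT]
  refine ⟨_, ?_, (polarCoeff_apply hd hdeg j g).symm⟩
  rw [← degree_toHat hd]
  exact (isDigit_digitX₁ hd hdeg _).1

theorem polarCoeff_mul {l : RatFun K m} (hl : l ∈ fieldHat K m) (g : RatFun K m) :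
    polarCoeff hd hdeg j (l * g) = l * polarCoeff hd hdeg j g := by
  have hC : evalX₁ K m (C ⟨l, hl⟩) = l := evalX₁_C _
  have := IsDigit.C_mul (φ := evalX₁ K m) (p := toHat K m d)
    (isDigit_digitX₁ hd hdeg (algebraMap (MPoly K m) (RatFun K m) d ^ j * g)) ⟨l, hl⟩
  rw [hC, mul_left_comm] at this
  rw [polarCoeff_eq hd hdeg j this, map_mul, hC, polarCoeff_apply]

theorem polarCoeff_smul {σ : GrpT K h} (hσ : σ ∈ isoT h d) (g : RatFun K m) :
    polarCoeff hd hdeg j (σ • g) = σ • polarCoeff hd hdeg j g := by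
  have hmap : ∀ (ρ : GrpT K h) (N : ℕ) (u : (fieldHat K m)[X]), u.degree < N →
      ∃ u' : (fieldHat K m)[X], u'.degree < N ∧ evalX₁ K m u' = ρ • evalX₁ K m u := by
    intro ρ N u hu
    have := smul_mem_polyDegLT ρ
      (mem_polyDegLTAddSubgroup.2 (mem_polyDegLT.2 ⟨u, hu, rfl⟩))
    exact mem_polyDegLT.1 (mem_polyDegLTAddSubgroup.1 this)
  obtain ⟨v', -, hv'⟩ := mem_polyDegLT.1 (mem_polyDegLTAddSubgroup.1
    (smul_mem_polyDegLT σ (polarCoeff_mem hd hdeg j g)))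
  have := IsDigit.map (φ := evalX₁ K m) (p := toHat K m d)
    (σ := (σ : RatFun K m ≃ₐ[K] RatFun K m).toRingEquiv)
    evalX₁_injective (prime_toHat hd hdeg) (hmap σ) (hmap σ⁻¹)
    (by
      change σ • evalX₁ K m (toHat K m d) = evalX₁ K m (toHat K m d)
      rw [evalX₁_toHat, smul_eq_of_mem_isoT hσ])
    (isDigit_digitX₁ hd hdeg (algebraMap (MPoly K m) (RatFun K m) d ^ j * g)) (v' := v')
    (by rw [hv', polarCoeff_apply]; rfl)
  rw [← hv']
  apply polarCoeff_eq
  have e : σ • (algebraMap (MPoly K m) (RatFun K m) d ^ j * g) =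
      algebraMap (MPoly K m) (RatFun K m) d ^ j * σ • g := by
    rw [smul_mul', smul_pow', smul_eq_of_mem_isoT hσ]
  rw [← e]
  exact this

theorem polarCoeff_div {a : RatFun K m}
    (ha : a ∈ polyDegLTAddSubgroup K m (d.degreeOf (x₁ m))) :
    polarCoeff hd hdeg j (a / algebraMap (MPoly K m) (RatFun K m) d ^ j) = a := by
  obtain ⟨v, hv, rfl⟩ := mem_polyDegLT.1 (mem_polyDegLTAddSubgroup.1 ha)
  apply polarCoeff_eq
  have hd0 : algebraMap (MPoly K m) (RatFun K m) d ≠ 0 :=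
    (map_ne_zero_iff _ (IsFractionRing.injective _ _)).2 hd.ne_zero
  rw [mul_div_cancel₀ _ (pow_ne_zero j hd0)]
  rw [← degree_toHat hd] at hv
  simpa using isDigit_of_integral (φ := evalX₁ K m) (u := 0) hv
    (s := 1) (fun h1 => (prime_toHat hd hdeg).not_isUnit (isUnit_of_dvd_one h1))

/-- A rational function whose denominator is prime to `d` has no polar part at `d`. -/
theorem polarCoeff_eq_zero (hj : 1 ≤ j) (u : (fieldHat K m)[X]) {s : MPoly K m} (hs : ¬ d ∣ s) :
    polarCoeff hd hdeg j (evalX₁ K m u / algebraMap (MPoly K m) (RatFun K m) s) = 0 := by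
  rw [polarCoeff_eq hd hdeg j (v := 0), map_zero]
  have := isDigit_of_integral (φ := evalX₁ K m) (v := 0)
    (u := toHat K m d ^ (j - 1) * u) (p := toHat K m d) (s := toHat K m s)
    (by rw [degree_zero, bot_lt_iff_ne_bot, degree_ne_bot]; exact (prime_toHat hd hdeg).ne_zero)
    (fun h => hs ((toHat_dvd_toHat_iff hd hdeg).1 h))
  convert this using 1
  simp only [map_zero, zero_add, map_mul, map_pow, evalX₁_toHat]
  obtain ⟨j, rfl⟩ := Nat.exists_eq_add_of_le' hj
  rw [Nat.add_sub_cancel, pow_succ']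
  ring

include hd in
/-- The translates of `d` occurring in the denominator of `g` are finitely many. -/
theorem finite_polarCoeff_ne_zero (hj : 1 ≤ j) (g : RatFun K m) :
    {c : GrpX K h ⧸ (isoX h d).subgroupOf (GrpX K h) |
      polarCoeff hd hdeg j (c.out⁻¹ • g) ≠ 0}.Finite := by
  obtain ⟨u, s, hs, rfl⟩ := IsFractionRing.div_surjective (A := MPoly K m) g
  have hs0 := nonZeroDivisors.ne_zero hs
  let D : GrpX K h ⧸ (isoX h d).subgroupOf (GrpX K h) → Associates (MPoly K m) := fun c =>
    Associates.mk (polySmul (c.out : GrpT K h) d)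
  have hfin : {x : Associates (MPoly K m) | x ∣ Associates.mk s}.Finite :=
    @Set.toFinite _ _ (@Finite.of_fintype _
      (UniqueFactorizationMonoid.fintypeSubtypeDvd _ (Associates.mk_ne_zero.2 hs0)))
  refine Set.Finite.of_finite_image (f := D) (hfin.subset ?_) ?_
  · rintro _ ⟨c, hc, rfl⟩
    rw [Set.mem_ofPred_eq, Associates.mk_dvd_mk]
    by_contra hdvd
    refine hc ?_
    have := polarCoeff_eq_zero hd hdeg j hj (toHat K m (polySmul (c.out⁻¹ : GrpT K h) u))
      (s := polySmul (c.out⁻¹ : GrpT K h) s) (fun hds => hdvd ?_)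
    · rw [evalX₁_toHat, algebraMap_polySmul, algebraMap_polySmul] at this
      rw [← this]
      congr 1
      exact smul_div₀' (c.out⁻¹ : GrpT K h) _ _
    · have := map_dvd (polySmul (c.out : GrpT K h)) hds
      rwa [← polySmul_mul, mul_inv_cancel, polySmul_one] at this
  · intro c _ c' _ hcc
    have hassoc : polySmul (c.out : GrpT K h) d ∣ polySmul (c'.out : GrpT K h) d :=
      (Associates.mk_eq_mk_iff_associated.1 hcc).dvd
    have := map_dvd (polySmul (c.out : GrpT K h)⁻¹) hassoc
    rw [polySmul_inv_polySmul, ← polySmul_mul] at this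
    have hmem := mem_isoT_of_dvd hd this
    rw [← c.out_eq', ← c'.out_eq']
    exact QuotientGroup.eq.2 (mem_isoX_iff.2 ⟨(c.out⁻¹ * c'.out).2, hmem⟩)

/-- For `σ` in `G_t`, the fraction `σ (a / d ^ j)` has denominator `(σ d) ^ j`, so it has
a polar part at `d` only if `σ` fixes `d`. -/
theorem polarCoeff_smul_div_eq_zero (hj : 1 ≤ j) {a : RatFun K m}
    (ha : a ∈ polyDegLTAddSubgroup K m (d.degreeOf (x₁ m))) {σ : GrpT K h} (hσ : σ ∉ isoT h d) :
    polarCoeff hd hdeg j (σ • (a / algebraMap (MPoly K m) (RatFun K m) d ^ j)) = 0 := by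
  obtain ⟨u, -, hu⟩ := mem_polyDegLT.1 (mem_polyDegLTAddSubgroup.1 (smul_mem_polyDegLT σ ha))
  have := polarCoeff_eq_zero hd hdeg j hj u (s := polySmul σ d ^ j)
    (fun hdvd => hσ (mem_isoT_of_dvd hd (hd.prime.dvd_of_dvd_pow hdvd)))
  rwa [hu, map_pow, algebraMap_polySmul, ← smul_pow', ← smul_div₀'] at this

end PolarPart

/-! ### Telescopers and relations under the isotropy group -/

section Telescoper

variable {K : Type*} [Field K] {m n : ℕ} {h : n ≤ m} {d : MPoly K m}

/-- A relation with negative powers of `μ` becomes an operator with nonnegative powers after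
applying a large power of `μ`. -/
theorem exists_applyOp_mem {μ : GrpT K h} {W : AddSubgroup (RatFun K m)}
    (hW : ∀ (σ : GrpT K h), ∀ w ∈ W, σ • w ∈ W) {ι : Type*} {s : Finset ι} {q : ι → ℤ}
    (hq : Set.InjOn q s) {l : ι → RatFun K m} (hl : ∀ i, l i ∈ fieldT K m) {i₀ : ι} (hi₀ : i₀ ∈ s)
    (h0 : l i₀ ≠ 0) {a : RatFun K m} (hmem : ∑ i ∈ s, l i * μ ^ q i • a ∈ W) :
    ∃ L : ℕ →₀ fieldT K m, L ≠ 0 ∧ applyOp (μ : RatFun K m ≃ₐ[K] RatFun K m) L a ∈ W := by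
  classical
  let N : ℕ := s.sup fun i => (q i).natAbs
  have hN : ∀ i ∈ s, (((N + q i).toNat : ℕ) : ℤ) = N + q i := fun i hi => by
    have : (q i).natAbs ≤ N := Finset.le_sup (f := fun i => (q i).natAbs) hi
    omega
  let L : ℕ →₀ fieldT K m :=
    ∑ i ∈ s, Finsupp.single (N + q i).toNat ⟨μ ^ N • l i, smul_mem_fieldT _ (hl i)⟩
  refine ⟨L, fun hL => ?_, ?_⟩
  · have hc : L (N + q i₀).toNat = 0 := by rw [hL]; rfl
    rw [Finsupp.finsetSum_apply, Finset.sum_eq_single i₀] at hc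
    · rw [Finsupp.single_eq_same, Subtype.ext_iff] at hc
      exact h0 ((smul_eq_zero_iff_eq (μ ^ N)).1 hc)
    · intro i hi hne
      refine Finsupp.single_eq_of_ne fun he => hne (hq hi hi₀ ?_)
      have h1 := hN i hi
      have h2 := hN i₀ hi₀
      omega
    · exact fun hi => absurd hi₀ hi
  · have : applyOp (μ : RatFun K m ≃ₐ[K] RatFun K m) L a =
        μ ^ N • ∑ i ∈ s, l i * μ ^ q i • a := by
      rw [applyOp, ← Finsupp.sum_finsetSum_index (fun _ => by simp) (fun _ _ _ => by
        simp [add_mul]), Finset.smul_sum]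
      refine Finset.sum_congr rfl fun i hi => ?_
      rw [Finsupp.sum_single_index (by simp), smul_mul', smul_smul, ← zpow_natCast μ N,
        ← zpow_add, ← hN i hi, zpow_natCast μ (Int.toNat _)]
      rfl
    rw [this]
    exact hW _ _ hmem

theorem applyOp_eq_sum (μ : GrpT K h) (L : ℕ →₀ fieldT K m) (f : RatFun K m) :
    applyOp (μ : RatFun K m ≃ₐ[K] RatFun K m) L f =
      ∑ i ∈ L.support, (L i : RatFun K m) * μ ^ i • f :=
  rfl

theorem hasTelescoper_iff {f : RatFun K m} :
    HasTelescoper h f ↔ ∃ L : ℕ →₀ fieldT K m, L ≠ 0 ∧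
      applyOp (shiftT K h : RatFun K m ≃ₐ[K] RatFun K m) L f ∈ deltaSpan (shiftX K h) ⊤ := by
  refine exists_congr fun L => and_congr_right fun _ => ?_
  rw [mem_deltaSpan]
  exact exists_congr fun g => ⟨fun hg => ⟨fun _ => AddSubgroup.mem_top _, hg⟩, fun hg => hg.2⟩

theorem exists_eq_zpow_mul {τ₀ : isoT h d} (hquot : Subgroup.zpowers (isoQuot.mk τ₀) = ⊤)
    {σ : GrpT K h} (hσ : σ ∈ isoT h d) :
    ∃ (q : ℤ) (ρ : GrpT K h), ρ ∈ isoX h d ∧ σ = (τ₀ : GrpT K h) ^ q * ρ := by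
  have hmem : isoQuot.mk ⟨σ, hσ⟩ ∈ Subgroup.zpowers (isoQuot.mk τ₀) :=
    hquot ▸ Subgroup.mem_top _
  obtain ⟨q, hq⟩ := Subgroup.mem_zpowers_iff.1 hmem
  have hpow : isoQuot.mk (τ₀ ^ q) = isoQuot.mk τ₀ ^ q := rfl
  rw [← hpow] at hq
  have hmem' := Subgroup.mem_subgroupOf.1 (QuotientGroup.eq.1 hq)
  refine ⟨q, _, hmem', ?_⟩
  rw [Subgroup.coe_mul, Subgroup.coe_inv, Subgroup.coe_zpow, mul_inv_cancel_left]

/-- A generator of a quotient `G_{t,d} / G_d` of rank one involves a nonzero power of `σ_t`. -/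
theorem not_mem_GrpX (hrank : Module.finrank ℤ (Additive (isoQuot h d)) = 1) {τ₀ : isoT h d}
    (hquot : Subgroup.zpowers (isoQuot.mk τ₀) = ⊤) : (τ₀ : GrpT K h) ∉ GrpX K h := by
  intro hmem
  have h1 : isoQuot.mk τ₀ = isoQuot.mk 1 :=
    (QuotientGroup.eq.2 (Subgroup.mem_subgroupOf.2 (by
      rw [mul_one]
      exact inv_mem (mem_isoX_iff.2 ⟨hmem, τ₀.2⟩)))  :
      ((τ₀ : isoT h d ⧸ (isoX h d).subgroupOf (isoT h d))) = ((1 : isoT h d) :))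
  have h2 : (isoQuot.mk 1 : isoQuot h d) = 1 := rfl
  rw [h1, h2, Subgroup.zpowers_one_eq_bot] at hquot
  have h3 : ∀ x : isoQuot h d, x = 1 := fun x => Subgroup.mem_bot.1 (hquot ▸ Subgroup.mem_top x)
  have : Subsingleton (Additive (isoQuot h d)) := ⟨fun x y => (h3 x).trans (h3 y).symm⟩
  rw [Module.finrank_zero_of_subsingleton] at hrank
  exact zero_ne_one hrank

/-- A relation for `a` under the isotropy group, divided by the invariant `d ^ j`, gives a
telescoper: modulo sums of differences, `τ₀` acts as a nonzero power of `σ_t`. -/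
theorem hasTelescoper_of_applyOp_mem [NeZero m] {r j : ℕ} {τ₀ : isoT h d} {τ : Fin r → GrpT K h}
    (hτ₀ : (τ₀ : GrpT K h) ∉ GrpX K h) (hτ : ∀ i, τ i ∈ isoX h d) {X : AddSubgroup (RatFun K m)}
    {a : RatFun K m} {L : ℕ →₀ fieldT K m} (hL : L ≠ 0)
    (ha : applyOp (τ₀ : RatFun K m ≃ₐ[K] RatFun K m) L a ∈ deltaSpan τ X) :
    HasTelescoper h (a / algebraMap (MPoly K m) (RatFun K m) d ^ j) := by
  rw [hasTelescoper_iff]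
  set D := algebraMap (MPoly K m) (RatFun K m) d ^ j with hD
  set U := deltaSpan (shiftX K h) (⊤ : AddSubgroup (RatFun K m))
  have hfix : ∀ σ ∈ isoT h d, σ • D = D := fun σ hσ => by
    rw [hD, smul_pow', smul_eq_of_mem_isoT hσ]
  have hUX : ∀ σ ∈ GrpX K h, ∀ g : RatFun K m, σ • g - g ∈ U := fun σ hσ g =>
    smul_sub_mem_deltaSpan (fun _ _ _ => AddSubgroup.mem_top _)
      (by rwa [closure_range_shiftX]) (AddSubgroup.mem_top _)
  have hUT : ∀ l ∈ fieldT K m, ∀ w ∈ U, l * w ∈ U := fun l hl w hw =>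
    mul_mem_deltaSpan (fun i => smul_eq_of_mem_GrpX
      (by rw [← closure_range_shiftX]; exact Subgroup.subset_closure ⟨i, rfl⟩) hl)
      (fun _ _ => AddSubgroup.mem_top _) hw
  -- Division by the invariant `d ^ j` gives a relation for `f = a / d ^ j`.
  have h1 : ∑ i ∈ L.support, (L i : RatFun K m) * (τ₀ : GrpT K h) ^ i • (a / D) ∈ U := by
    have e : ∑ i ∈ L.support, (L i : RatFun K m) * (τ₀ : GrpT K h) ^ i • (a / D) =
        applyOp (τ₀ : RatFun K m ≃ₐ[K] RatFun K m) L a / D := by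
      rw [applyOp_eq_sum, Finset.sum_div]
      refine Finset.sum_congr rfl fun i _ => ?_
      rw [smul_div₀', hfix _ (pow_mem τ₀.2 i), mul_div_assoc]
    obtain ⟨b, -, hb⟩ := ha
    rw [e, hb, Finset.sum_div]
    refine sum_mem fun i _ => ?_
    have := hUX (τ i) (mem_isoX_iff.1 (hτ i)).1 (b i / D)
    rwa [smul_div₀', hfix _ (mem_isoX_iff.1 (hτ i)).2, ← sub_div] at this
  obtain ⟨k, ρ, hρ, hk⟩ := exists_eq_shiftT_zpow_mul (τ₀ : GrpT K h)
  have hk0 : k ≠ 0 := by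
    rintro rfl
    rw [zpow_zero, one_mul] at hk
    exact hτ₀ (hk ▸ hρ)
  -- Modulo the sums of differences, `τ₀ ^ i` acts as `σ_t ^ (k * i)`.
  have h2 : ∑ i ∈ L.support, (L i : RatFun K m) * shiftT K h ^ (k * i) • (a / D) ∈ U := by
    have : ∑ i ∈ L.support, (L i : RatFun K m) * ((τ₀ : GrpT K h) ^ i • (a / D)) -
        ∑ i ∈ L.support, (L i : RatFun K m) * shiftT K h ^ (k * i) • (a / D) ∈ U := by
      rw [← Finset.sum_sub_distrib]
      refine sum_mem fun i _ => ?_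
      rw [← mul_sub, hk, mul_pow, ← zpow_natCast (shiftT K h ^ k), ← zpow_mul, mul_comm _ (ρ ^ i),
        mul_smul]
      exact hUT _ (L i).2 _ (hUX _ (pow_mem hρ i) _)
    have := sub_mem h1 this
    rwa [sub_sub_cancel] at this
  obtain ⟨i₀, hi₀⟩ := Finsupp.support_nonempty_iff.2 hL
  have hUσ : ∀ σ : GrpT K h, ∀ w ∈ U, σ • w ∈ U := fun σ w hw =>
    smul_mem_deltaSpan (fun _ _ => AddSubgroup.mem_top _) hw
  have hinj : Set.InjOn (fun i : ℕ => k * (i : ℤ)) L.support := fun i _ i' _ hii =>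
    Nat.cast_injective (mul_left_cancel₀ hk0 hii)
  have hi₀' : (L i₀ : RatFun K m) ≠ 0 := fun h0 =>
    Finsupp.mem_support_iff.1 hi₀ (Subtype.ext h0)
  exact exists_applyOp_mem (μ := shiftT K h) (W := U) hUσ hinj (l := fun i => (L i : RatFun K m))
    (fun i => (L i).2) hi₀ hi₀' h2

/-- The transfer of the polar parts along the `G`-translates of `d` sends a telescoping relation
to a relation for `a`, with coefficients in `K(t)`, modulo the differences under `G_d`. -/
theorem applyOp_mem_of_hasTelescoper [CharZero K] [NeZero m] (hd : Irreducible d)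
    (hdeg : 0 < d.degreeOf (x₁ m)) {j : ℕ} (hj : 1 ≤ j) {r : ℕ} {τ₀ : isoT h d}
    {τ : Fin r → GrpT K h} (hquot : Subgroup.zpowers (isoQuot.mk τ₀) = ⊤)
    (hτ : Subgroup.closure (Set.range τ) = isoX h d) {a : RatFun K m}
    (ha : a ∈ polyDegLTAddSubgroup K m (d.degreeOf (x₁ m)))
    (hf : HasTelescoper h (a / algebraMap (MPoly K m) (RatFun K m) d ^ j)) :
    ∃ L : ℕ →₀ fieldT K m, L ≠ 0 ∧ applyOp (τ₀ : RatFun K m ≃ₐ[K] RatFun K m) L a ∈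
      deltaSpan τ (polyDegLTAddSubgroup K m (d.degreeOf (x₁ m))) := by
  classical
  obtain ⟨L, hL, hLU⟩ := hasTelescoper_iff.1 hf
  set f := a / algebraMap (MPoly K m) (RatFun K m) d ^ j
  set V := polyDegLTAddSubgroup K m (d.degreeOf (x₁ m))
  set W := deltaSpan τ V
  have hV : ∀ σ : GrpT K h, ∀ v ∈ V, σ • v ∈ V := fun σ v hv => smul_mem_polyDegLT σ hv
  have hWX : ∀ ρ ∈ isoX h d, ∀ v ∈ V, ρ • v - v ∈ W := fun ρ hρ v hv =>
    smul_sub_mem_deltaSpan hV (hτ ▸ hρ) hv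
  have hτX : ∀ i, τ i ∈ isoX h d := fun i => hτ ▸ Subgroup.subset_closure ⟨i, rfl⟩
  obtain ⟨s, hs⟩ := Finsupp.support_nonempty_iff.2 hL
  -- Shifting by `σ_t ^ (-s)` makes the exponent `0` occur, which is seen by the polar part at `d`.
  let l : ℕ → RatFun K m := fun i => shiftT K h ^ (-s : ℤ) • (L i : RatFun K m)
  have hl : ∀ i, l i ∈ fieldT K m := fun i => smul_mem_fieldT _ (L i).2
  have hw : ∑ i ∈ L.support, l i * shiftT K h ^ ((i : ℤ) - s) • f ∈
      deltaSpan (shiftX K h) (⊤ : AddSubgroup (RatFun K m)) := by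
    have := smul_mem_deltaSpan (σ := shiftT K h ^ (-s : ℤ)) (fun _ _ => AddSubgroup.mem_top _) hLU
    rw [applyOp_eq_sum, Finset.smul_sum] at this
    convert this using 2 with i
    rw [smul_mul', smul_smul, ← zpow_natCast, ← zpow_add, neg_add_eq_sub]
  -- The map to the coinvariants `V ⧸ W` given by the polar parts at the `G`-translates of `d`.
  let δ : RatFun K m →+ RatFun K m ⧸ W := (QuotientAddGroup.mk' W).comp (polarCoeff hd hdeg j)
  have hδ : ∀ ρ ∈ (isoX h d).subgroupOf (GrpX K h), ∀ g : RatFun K m, δ (ρ • g) = δ g := by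
    intro ρ hρ g
    have hρ' : (ρ : GrpT K h) ∈ isoX h d := hρ
    change ((polarCoeff hd hdeg j ((ρ : GrpT K h) • g) : RatFun K m) : RatFun K m ⧸ W) =
      (polarCoeff hd hdeg j g : RatFun K m)
    rw [polarCoeff_smul hd hdeg j (mem_isoX_iff.1 hρ').2, ← sub_eq_zero, ← QuotientAddGroup.mk_sub,
      QuotientAddGroup.eq_zero_iff]
    exact hWX _ hρ' _ (polarCoeff_mem hd hdeg j g)
  have hfin : ∀ g : RatFun K m, {c : GrpX K h ⧸ (isoX h d).subgroupOf (GrpX K h) |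
      δ (c.out⁻¹ • g) ≠ 0}.Finite := fun g =>
    (finite_polarCoeff_ne_zero hd hdeg j hj g).subset fun c hc h0 => hc (by
      change ((polarCoeff hd hdeg j (c.out⁻¹ • g) : RatFun K m) : RatFun K m ⧸ W) = 0
      rw [h0]; rfl)
  have hzero := transfer_eq_zero_of_mem_deltaSpan hδ hfin
    (fun i => by rw [← closure_range_shiftX]; exact Subgroup.subset_closure ⟨i, rfl⟩) hw
  -- The value of `δ` on a translate of a term of the telescoping relation.
  have hval : ∀ (c : GrpX K h) (e : ℤ) (i : ℕ),
      δ (c⁻¹ • (l i * shiftT K h ^ e • f)) =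
        ((l i * polarCoeff hd hdeg j (((c : GrpT K h)⁻¹ * shiftT K h ^ e) • f) : RatFun K m) :
          RatFun K m ⧸ W) := by
    intro c e i
    have : c⁻¹ • (l i * shiftT K h ^ e • f) =
        l i * ((c : GrpT K h)⁻¹ * shiftT K h ^ e) • f := by
      change (c : GrpT K h)⁻¹ • (l i * shiftT K h ^ e • f) = _
      rw [smul_mul', smul_eq_of_mem_GrpX (inv_mem c.2) (hl i), smul_smul]
    rw [this, ← polarCoeff_mul hd hdeg j (fieldT_le_fieldHat (hl i))]
    rfl
  let P : ℕ → Prop := fun i =>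
    ∃ q : ℤ, (τ₀ : GrpT K h) ^ q * (shiftT K h ^ ((i : ℤ) - s))⁻¹ ∈ GrpX K h
  let q : ℕ → ℤ := fun i => if hi : P i then hi.choose else 0
  have hq : ∀ i, P i → (τ₀ : GrpT K h) ^ q i * (shiftT K h ^ ((i : ℤ) - s))⁻¹ ∈ GrpX K h :=
    fun i hi => by
      simp only [q, dif_pos hi]
      exact hi.choose_spec
  -- A coset contributes to the `i`-th term only if `σ_t ^ (i - s) d` is a `G`-translate of `d`.
  have hout : ∀ (c : GrpX K h) (i : ℕ), ¬ P i →
      δ (c⁻¹ • (l i * shiftT K h ^ ((i : ℤ) - s) • f)) = 0 := by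
    intro c i hi
    rw [hval, polarCoeff_smul_div_eq_zero hd hdeg j hj ha, mul_zero]
    · rfl
    · intro hmem
      obtain ⟨k, ρ, hρ, hk⟩ := exists_eq_zpow_mul hquot hmem
      refine hi ⟨k, ?_⟩
      have e : (τ₀ : GrpT K h) ^ k * (shiftT K h ^ ((i : ℤ) - s))⁻¹ = (c : GrpT K h)⁻¹ * ρ⁻¹ := by
        rw [eq_mul_inv_iff_mul_eq, mul_right_comm, ← hk, mul_inv_cancel_right]
      rw [e]
      exact mul_mem (inv_mem c.2) (inv_mem (mem_isoX_iff.1 hρ).1)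
  have hin : ∀ i, P i → transfer ((isoX h d).subgroupOf (GrpX K h)) δ
      (l i * shiftT K h ^ ((i : ℤ) - s) • f) =
        ((l i * (τ₀ : GrpT K h) ^ q i • a : RatFun K m) : RatFun K m ⧸ W) := by
    intro i hi
    set γ : GrpX K h := ⟨_, hq i hi⟩
    have hγ : (γ : GrpT K h) * shiftT K h ^ ((i : ℤ) - s) = (τ₀ : GrpT K h) ^ q i :=
      inv_mul_cancel_right _ _
    have hτq : (τ₀ : GrpT K h) ^ q i ∈ isoT h d := zpow_mem τ₀.2 _
    rw [transfer_eq_single hδ γ⁻¹]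
    · rw [hval, InvMemClass.coe_inv, inv_inv, hγ, polarCoeff_smul hd hdeg j hτq,
        polarCoeff_div hd hdeg j ha]
    · intro c hc
      rw [hval, polarCoeff_smul_div_eq_zero hd hdeg j hj ha, mul_zero]
      · rfl
      · intro hmem
        refine hc ?_
        rw [← c.out_eq']
        refine QuotientGroup.eq.2 (mem_isoX_iff.2 ⟨(c.out⁻¹ * γ⁻¹).2, ?_⟩)
        have e : ((c.out : GrpT K h)⁻¹ * shiftT K h ^ ((i : ℤ) - s)) * ((τ₀ : GrpT K h) ^ q i)⁻¹ =
            ((c.out⁻¹ * γ⁻¹ : GrpX K h) : GrpT K h) := by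
          rw [← hγ, mul_inv, mul_comm (γ : GrpT K h)⁻¹, mul_assoc, mul_inv_cancel_left]
          rfl
        change ((c.out⁻¹ * γ⁻¹ : GrpX K h) : GrpT K h) ∈ isoT h d
        rw [← e]
        exact mul_mem hmem (inv_mem hτq)
  have hP : P s := ⟨0, by simp⟩
  refine exists_applyOp_mem (s := L.support.filter P) (q := q) (l := l) (i₀ := s)
    (fun σ w hw => smul_mem_deltaSpan (hV σ) hw) ?_ hl (Finset.mem_filter.2 ⟨hs, hP⟩) ?_ ?_
  · intro i hi i' hi' hii
    have h1 := hq i (Finset.mem_filter.1 hi).2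
    have h2 := hq i' (Finset.mem_filter.1 hi').2
    rw [hii] at h1
    have h3 := mul_mem (inv_mem h1) h2
    have e : ((τ₀ : GrpT K h) ^ q i' * (shiftT K h ^ ((i : ℤ) - s))⁻¹)⁻¹ *
        ((τ₀ : GrpT K h) ^ q i' * (shiftT K h ^ ((i' : ℤ) - s))⁻¹) =
        shiftT K h ^ ((i : ℤ) - i') := by
      rw [mul_inv, inv_inv, mul_comm ((τ₀ : GrpT K h) ^ q i')⁻¹, mul_assoc, inv_mul_cancel_left,
        ← zpow_neg, ← zpow_add]
      congr 1
      ring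
    rw [e, shiftT_zpow_mem_GrpX_iff] at h3
    omega
  · have := Finsupp.mem_support_iff.1 hs
    exact fun h0 => this (Subtype.ext ((smul_eq_zero_iff_eq _).1 h0))
  · let Φ : RatFun K m →+ RatFun K m ⧸ W :=
      ⟨⟨transfer ((isoX h d).subgroupOf (GrpX K h)) δ, transfer_zero⟩, transfer_add hfin⟩
    change Φ _ = 0 at hzero
    rw [← QuotientAddGroup.eq_zero_iff, ← hzero, map_sum, Finset.sum_filter]
    change QuotientAddGroup.mk' W _ = _
    rw [map_sum]
    refine Finset.sum_congr rfl fun i _ => ?_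
    split_ifs with hi
    · exact (hin i hi).symm
    · rw [map_zero]
      change 0 = transfer _ δ _
      rw [transfer]
      exact (finsum_eq_zero_of_forall_eq_zero fun c => hout _ i hi).symm

end Telescoper

end Telescoping

end

open Telescoping
theorem theorem3 {K : Type*} [Field K] [CharZero K] (m n : ℕ) [NeZero m] (hn : 1 ≤ n) (h : n ≤ m)
    (d : MPoly K m) (hd : Irreducible d) (j : ℕ) (hj : 1 ≤ j)
    (a : RatFun K m) (ha : a ∈ polyDegLT K m (d.degreeOf (x₁ m)))
    (hrank : Module.finrank ℤ (Additive (isoQuot h d)) = 1)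
    (r : ℕ) (τ₀ : isoT h d) (τ : Fin r → GrpT K h)
    (hbasis : IsZBasis (isoT h d) (Fin.cons (τ₀ : GrpT K h) τ : Fin (r + 1) → GrpT K h))
    (hquot : Subgroup.zpowers (isoQuot.mk τ₀) = ⊤)
    (hbasis' : IsZBasis (isoX h d) τ) :
    HasTelescoper h (a / algebraMap (MPoly K m) (RatFun K m) d ^ j) ↔
      ∃ L : ℕ →₀ fieldT K m, L ≠ 0 ∧ ∃ b : Fin r → RatFun K m,
        (∀ i, b i ∈ polyDegLT K m (d.degreeOf (x₁ m))) ∧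
        applyOp (τ₀ : GrpT K h) L a = ∑ i, deltaOp (τ i : RatFun K m ≃ₐ[K] RatFun K m) (b i) := by
  have key : ∀ w : RatFun K m, w ∈ deltaSpan τ (polyDegLTAddSubgroup K m (d.degreeOf (x₁ m))) ↔
      ∃ b : Fin r → RatFun K m, (∀ i, b i ∈ polyDegLT K m (d.degreeOf (x₁ m))) ∧
        w = ∑ i, deltaOp (τ i : RatFun K m ≃ₐ[K] RatFun K m) (b i) := fun w => by
    simp only [← mem_polyDegLTAddSubgroup]
    exact mem_deltaSpan
  simp only [← key]
  constructor
  · intro hf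
    rcases Nat.eq_zero_or_pos (d.degreeOf (x₁ m)) with h0 | hdeg
    · -- Only `a = 0` has negative degree.
      have ha0 : a = 0 := by
        obtain ⟨p, hp, rfl⟩ := ha
        rw [h0, Nat.cast_zero, ← not_le, Polynomial.zero_le_degree_iff, not_not] at hp
        rw [hp, map_zero]
      refine ⟨Finsupp.single 0 1, by simp, ?_⟩
      rw [ha0, applyOp, Finsupp.sum_single_index (by simp), map_zero, mul_zero]
      exact zero_mem _
    · exact applyOp_mem_of_hasTelescoper hd hdeg hj hquot hbasis'.closure_eq
        (mem_polyDegLTAddSubgroup.2 ha) hf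
  · rintro ⟨L, hL, hLa⟩
    exact hasTelescoper_of_applyOp_mem (not_mem_GrpX hrank hquot)
      (fun i => hbasis'.closure_eq ▸ Subgroup.subset_closure ⟨i, rfl⟩) hL hLa
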